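/- Let $F$ be a (real) Banach lattice with order continuous norm, that is, $\|f_p\|\to 0$ for every net $(f_p)$ in $F$ decreasing to $0$. Let $H$ be a Banach space and let $T:F\to H$ be a bounded linear operator. Put $S_F=\{f\in F:\|f\|=1\}$; elements $e,f\in F$ are disjoint if $|e|\wedge|f|=0$, and a sequence or tuple is disjoint if its entries are pairwise disjoint. The un-topology on $F$ is the linear topology determined by the neighbourhoods of zero $\{f:\||f|\wedge h\|<\varepsilon\}$ with $h\in F_+$, $\varepsilon>0$; the uaw-topology is the linear topology determined by the neighbourhoods of zero $\{f:\nu(|f|\wedge h)<\varepsilon\}$ with $h\in F_+$, $\nu\in F^*_+$, $\varepsilon>0$. A linear topology is locally solid if it has a base at zero of solid sets, and order continuous if every net decreasing to $0$ converges to $0$ in it. Then there is a weakest Hausdorff order continuous locally solid topology $\tau_F$ on $F$, it coincides with both the un-topology and the uaw-topology, and the following conditions are equivalent: 1. $T$ is disjointly non-singular (DNS): for every disjoint sequence $(f_k)_{k\in\mathbb N}$ of nonzero vectors of $F$, the restriction of $T$ to $\operatorname{span}\{f_k:k\in\mathbb N\}$ is not strictly singular, i.e. it is bounded from below on some infinite-dimensional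 subspace of this span; 2. $T$ is $\infty$-DNS: there is $r>0$ such that there is no disjoint sequence $(f_k)_{k\in\mathbb N}$ in $S_F$ with $\|Tf_k\|\le r$ for all $k$; 3. there is a natural number $n\ge 2$ such that $T$ is $n$-DNS: there is $r>0$ such that there is no disjoint $n$-tuple $f_1,\dots,f_n$ in $S_F$ with $\|Tf_k\|\le r$ for $k=1,\dots,n$; 4. $T$ complements $\tau_F$: there is no net $(f_p)$ in $S_F$ with $f_p\to 0$ in $\tau_F$ and $\|Tf_p\|\to 0$; 5. $T$ sequentially complements $\tau_F$: there is no sequence $(f_k)_{k\in\mathbb N}$ in $S_F$ with $f_k\to 0$ in $\tau_F$ and $\|Tf_k\|\to 0$. -/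

import Mathlib

open Filter Topology

universe u v

/-- Two elements of a vector lattice are disjoint if the meet of their absolute values is zero. -/
def LatDisjoint {F : Type*} [Lattice F] [AddCommGroup F] (x y : F) : Prop :=
  |x| ⊓ |y| = 0

section Topologies

variable (F : Type u) [NormedAddCommGroup F] [Lattice F] [NormedSpace ℝ F]

/-- The norm is order continuous: every net decreasing to zero is norm-null. (Every downward
directed subset of `F` is the range of such a net with an index set in the universe of `F`.) -/
def HasOrderContinuousNorm : Prop :=
  ∀ (P : Type u) [Preorder P] [IsDirectedOrder P] [Nonempty P] (f : P → F),
    Antitone f → IsGLB (Set.range f) 0 → Tendsto (fun p => ‖f p‖) atTop (𝓝 0)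

/-- The unbounded norm (un-) topology: the translation invariant topology whose neighbourhoods of
zero are determined by the sets `{g | ‖|g| ⊓ h‖ < ε}` with `0 ≤ h` and `0 < ε`. -/
def unTopology : TopologicalSpace F :=
  TopologicalSpace.generateFrom
    {U | ∃ h f : F, ∃ ε : ℝ, 0 ≤ h ∧ 0 < ε ∧ U = {g | ‖|g - f| ⊓ h‖ < ε}}

/-- The unbounded absolute weak (uaw-) topology: the translation invariant topology whose
neighbourhoods of zero are determined by the sets `{g | ν (|g| ⊓ h) < ε}` with `0 ≤ h`, `0 < ε`
and `ν` a positive continuous functional. -/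
def uawTopology : TopologicalSpace F :=
  TopologicalSpace.generateFrom
    {U | ∃ h f : F, ∃ ν : F →L[ℝ] ℝ, ∃ ε : ℝ, 0 ≤ h ∧ (∀ x : F, 0 ≤ x → 0 ≤ ν x) ∧ 0 < ε ∧
      U = {g | ν (|g - f| ⊓ h) < ε}}

variable {F}

/-- A locally solid topology: a linear topology with a base at zero consisting of solid sets. -/
structure IsLocallySolidTopology (t : TopologicalSpace F) : Prop where
  continuousAdd : @ContinuousAdd F t _
  continuousSMul : @ContinuousSMul ℝ F _ _ t
  solid_base : ∀ U ∈ @nhds F t 0, ∃ V ∈ @nhds F t 0,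
    LatticeOrderedAddCommGroup.IsSolid V ∧ V ⊆ U

/-- A topology is order continuous if every net decreasing to zero converges to zero in it
(for locally solid topologies this is the same as asking it of all nets order convergent to zero).
-/
def IsOrderContinuousTopology (t : TopologicalSpace F) : Prop :=
  ∀ (P : Type u) [Preorder P] [IsDirectedOrder P] [Nonempty P] (f : P → F),
    Antitone f → IsGLB (Set.range f) 0 → Tendsto f atTop (@nhds F t 0)

/-- `t` is the weakest Hausdorff order continuous locally solid topology on `F`. In Mathlib's order
on topologies `s ≤ t` means that `t` is weaker than `s`. -/
def IsMinimalHausdorffOrderContinuous (t : TopologicalSpace F) : Prop :=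
  IsGreatest {s : TopologicalSpace F |
    IsLocallySolidTopology s ∧ @T2Space F s ∧ IsOrderContinuousTopology s} t

end Topologies

section Operators

variable {F : Type u} [NormedAddCommGroup F] [NormedSpace ℝ F]
  {H : Type v} [NormedAddCommGroup H] [NormedSpace ℝ H]

/-- `T` is strictly singular if it is not bounded below on any infinite dimensional subspace. -/
def IsStrictlySingular (T : F →L[ℝ] H) : Prop :=
  ∀ G : Submodule ℝ F, ¬ FiniteDimensional ℝ G → ¬ ∃ c : ℝ, 0 < c ∧ ∀ x ∈ G, c * ‖x‖ ≤ ‖T x‖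

/-- `T` complements `t`: no net of unit vectors is at the same time `t`-null and null for the
seminorm `f ↦ ‖T f‖`. (The universe of `F` suffices for the index sets: a filter `l` on `F` is
the limit filter of a net indexed by the pairs `x ∈ s` with `s ∈ l`.) -/
def Complements (T : F →L[ℝ] H) (t : TopologicalSpace F) : Prop :=
  ¬ ∃ (P : Type u) (_ : Preorder P) (_ : IsDirectedOrder P) (_ : Nonempty P) (f : P → F),
    (∀ p, ‖f p‖ = 1) ∧ Tendsto f atTop (@nhds F t 0) ∧ Tendsto (fun p => ‖T (f p)‖) atTop (𝓝 0)

/-- `T` sequentially complements `t`: no sequence of unit vectors is at the same time `t`-null and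
null for the seminorm `f ↦ ‖T f‖`. -/
def SeqComplements (T : F →L[ℝ] H) (t : TopologicalSpace F) : Prop :=
  ¬ ∃ f : ℕ → F,
    (∀ k, ‖f k‖ = 1) ∧ Tendsto f atTop (@nhds F t 0) ∧ Tendsto (fun k => ‖T (f k)‖) atTop (𝓝 0)

variable [Lattice F]

/-- `T` is disjointly non-singular (DNS): its restriction to the span of any disjoint sequence (of
nonzero vectors) is not strictly singular. -/
def IsDNS (T : F →L[ℝ] H) : Prop :=
  ∀ f : ℕ → F, (∀ k, f k ≠ 0) → Pairwise (fun i j => LatDisjoint (f i) (f j)) →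
    ¬ IsStrictlySingular (T.comp (Submodule.span ℝ (Set.range f)).subtypeL)

/-- `T` is `∞`-DNS: for some `r > 0` there is no disjoint sequence of unit vectors `f k` such that
`‖T (f k)‖ ≤ r` for all `k`. -/
def IsInftyDNS (T : F →L[ℝ] H) : Prop :=
  ∃ r : ℝ, 0 < r ∧ ¬ ∃ f : ℕ → F,
    Pairwise (fun i j => LatDisjoint (f i) (f j)) ∧ ∀ k, ‖f k‖ = 1 ∧ ‖T (f k)‖ ≤ r

/-- `T` is `n`-DNS: for some `r > 0` there is no disjoint `n`-tuple of unit vectors `f k` such that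
`‖T (f k)‖ ≤ r` for all `k`. -/
def IsNDNS (n : ℕ) (T : F →L[ℝ] H) : Prop :=
  ∃ r : ℝ, 0 < r ∧ ¬ ∃ f : Fin n → F,
    Pairwise (fun i j => LatDisjoint (f i) (f j)) ∧ ∀ k, ‖f k‖ = 1 ∧ ‖T (f k)‖ ≤ r

end Operators

/-!
# Disjointly non-singular operators and the un-topology

The argument rests on one property of Banach lattices with order continuous norm: bounded directed
sets have suprema, and these are approached in every order continuous topology
(`HasOrderContinuousNorm.exists_isLUB`, `IsOrderContinuousTopology.exists_sub_mem`).

*The topology.* Let `t` be a Hausdorff order continuous locally solid topology and `0 ≤ h`. A sequence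
of solid neighbourhoods of zero, each absorbing twice the next one, has a component of `h` in its null
ideal, and over all such sequences these components decrease to zero, hence also in norm. If
positive `g n ≤ h` were taken in the `n`-th neighbourhood with norms bounded away from zero, their
truncated tail sums would decrease in norm to an element of the null ideal; so on `[0, h]` the
topology `t` controls the norm at zero (`IsLocallySolidTopology.exists_nhds_norm_lt`). Since
`f ↦ |f| ⊓ h` maps into `[0, h]`, the un-topology is weaker than `t`. The uaw-topology is weaker than
the un-topology and is itself Hausdorff, order continuous and locally solid, so the two coincide and
are the weakest topology of this kind.

*The operator.* The conditions are linked by the cycle DNS, complements, sequentially complements,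
`n`-DNS, `∞`-DNS, DNS.
* A un-null net of unit vectors on which `T` tends to zero contains a sequence which is nearly
  disjoint. Cutting off the overlaps gives disjoint unit vectors along which `T` is summable
  (`exists_disjoint_summable`), and then `T` is strictly singular on their span
  (`isStrictlySingular_of_summable`).
* Disjoint `n`-tuples of unit vectors, one for every `n`, lie in the ideal of a single vector `e`. As
  the norm on `[0, e]` is controlled by one positive functional `ν`, and the values of `ν` at disjoint
  elements of `[0, e]` add up to at most `ν e`, long tuples contain vectors nearly disjoint from `e`.
  These form a un-null sequence (`SeqComplements.exists_isNDNS`).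
* If `T` is strictly singular on the span of a disjoint sequence, it is small on unit vectors
  in successive blocks of that sequence (`IsStrictlySingular.exists_block`).
-/

/-! ### Disjointness in vector lattices -/

section LatticeGroup

variable {F : Type*} [AddCommGroup F] [Lattice F]

theorem LatDisjoint.symm {x y : F} (h : LatDisjoint x y) : LatDisjoint y x := by
  unfold LatDisjoint at *
  rwa [inf_comm]

variable [IsOrderedAddMonoid F]

theorem add_inf_le {a b h : F} (ha : 0 ≤ a) (hb : 0 ≤ b) (hh : 0 ≤ h) :
    (a + b) ⊓ h ≤ a ⊓ h + b ⊓ h := by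
  rw [add_inf, inf_add, inf_add]
  refine le_inf (le_inf inf_le_left ?_) (le_inf ?_ ?_)
  · exact inf_le_right.trans (le_add_of_nonneg_right hb)
  · exact inf_le_right.trans (le_add_of_nonneg_left ha)
  · exact inf_le_right.trans (le_add_of_nonneg_right hh)

theorem abs_add_inf_le (a b : F) {h : F} (hh : 0 ≤ h) :
    |a + b| ⊓ h ≤ |a| ⊓ h + |b| ⊓ h :=
  (inf_le_inf_right h (abs_add_le a b)).trans (add_inf_le (abs_nonneg a) (abs_nonneg b) hh)

theorem LatDisjoint.add {x y z : F} (hx : LatDisjoint x z) (hy : LatDisjoint y z) :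
    LatDisjoint (x + y) z := by
  unfold LatDisjoint at *
  refine le_antisymm ((abs_add_inf_le x y (abs_nonneg z)).trans (by rw [hx, hy, add_zero]))
    (le_inf (abs_nonneg _) (abs_nonneg _))

theorem LatDisjoint.zero_left (y : F) : LatDisjoint 0 y := by
  simp [LatDisjoint, abs_nonneg]

theorem LatDisjoint.sum {ι : Type*} {s : Finset ι} {f : ι → F} {z : F}
    (h : ∀ i ∈ s, LatDisjoint (f i) z) : LatDisjoint (∑ i ∈ s, f i) z :=
  Finset.sum_induction f (fun x => LatDisjoint x z) (fun _ _ => LatDisjoint.add)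
    (LatDisjoint.zero_left z) h

/-- A disjoint sum of positive elements is also their supremum, so it stays below `h`. -/
theorem sum_le_of_pairwise_latDisjoint {ι : Type*} (s : Finset ι) {g : ι → F} {h : F} (hh : 0 ≤ h)
    (hg : ∀ i, 0 ≤ g i) (hgh : ∀ i, g i ≤ h)
    (hd : Pairwise fun i j => LatDisjoint (g i) (g j)) : ∑ i ∈ s, g i ≤ h := by
  classical
  induction s using Finset.induction_on with
  | empty => simpa using hh
  | insert i s hi ih =>
    rw [Finset.sum_insert hi]
    have h1 : LatDisjoint (∑ j ∈ s, g j) (g i) :=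
      LatDisjoint.sum fun j hj => hd (fun e => hi (e ▸ hj))
    have h2 : (g i) ⊓ (∑ j ∈ s, g j) = 0 := by
      have := h1.symm
      unfold LatDisjoint at this
      rwa [abs_of_nonneg (hg i), abs_of_nonneg (Finset.sum_nonneg fun j _ => hg j)] at this
    rw [← inf_add_sup, h2, zero_add]
    exact sup_le (hgh i) ih

theorem LatDisjoint.abs_le_abs_add {x y : F} (h : LatDisjoint x y) : |x| ≤ |x + y| := by
  have h1 : |x| ≤ |x + y| + |y| := by
    simpa using abs_add_le (x + y) (-y)
  calc |x| = |x| ⊓ (|x + y| + |y|) := (inf_eq_left.2 h1).symm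
    _ = (|x + y| + |y|) ⊓ |x| := inf_comm _ _
    _ ≤ |x + y| ⊓ |x| + |y| ⊓ |x| := add_inf_le (abs_nonneg _) (abs_nonneg _) (abs_nonneg _)
    _ = |x + y| ⊓ |x| := by rw [show |y| ⊓ |x| = 0 from h.symm, add_zero]
    _ ≤ |x + y| := inf_le_left

end LatticeGroup

section VectorLattice

variable {F : Type*} [AddCommGroup F] [Lattice F] [Module ℝ F] [IsOrderedModule ℝ F]

theorem abs_smul_le (c : ℝ) (x : F) : |c • x| ≤ |c| • |x| := by
  have h1 : ∀ (c : ℝ) (x : F), c • x ≤ |c| • |x| := fun c x => by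
    rcases le_total 0 c with hc | hc
    · rw [abs_of_nonneg hc]
      exact smul_le_smul_of_nonneg_left (le_abs_self x) hc
    · rw [abs_of_nonpos hc, ← neg_smul_neg]
      exact smul_le_smul_of_nonneg_left (neg_le_abs x) (neg_nonneg.2 hc)
  refine abs_le'.2 ⟨h1 c x, ?_⟩
  rw [← neg_smul]
  simpa using h1 (-c) x

variable [IsOrderedAddMonoid F]

theorem smul_inf_le_smul_inf {c : ℝ} (hc : 1 ≤ c) (a : F) {h : F} (hh : 0 ≤ h) :
    (c • a) ⊓ h ≤ c • (a ⊓ h) := by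
  have hc0 : 0 < c := by linarith
  have : c • (a ⊓ h) = c • a ⊓ c • h := (OrderIso.smulRight hc0).map_inf a h
  rw [this]
  exact inf_le_inf_left _ (le_smul_of_one_le_left hh hc)

/-- Disjointness passes to elements dominated by multiples. -/
theorem LatDisjoint.of_abs_le_smul {x y a : F} (h : LatDisjoint x y) {c : ℝ}
    (ha : |a| ≤ c • |x|) : LatDisjoint a y := by
  unfold LatDisjoint at *
  have h2 : |a| ≤ (max 1 c) • |x| :=
    ha.trans (smul_le_smul_of_nonneg_right (le_max_right _ _) (abs_nonneg x))
  refine le_antisymm ?_ (le_inf (abs_nonneg _) (abs_nonneg _))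
  calc |a| ⊓ |y| ≤ ((max 1 c) • |x|) ⊓ |y| := inf_le_inf_right _ h2
    _ ≤ (max 1 c) • (|x| ⊓ |y|) := smul_inf_le_smul_inf (le_max_left _ _) _ (abs_nonneg y)
    _ = 0 := by rw [h, smul_zero]

theorem LatDisjoint.smul {x y : F} (h : LatDisjoint x y) (c : ℝ) : LatDisjoint (c • x) y :=
  h.of_abs_le_smul (abs_smul_le c x)

theorem LatDisjoint.mono {x y a b : F} (h : LatDisjoint x y) (ha : |a| ≤ |x|) (hb : |b| ≤ |y|) :
    LatDisjoint a b := by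
  have h1 : LatDisjoint a y := h.of_abs_le_smul (c := 1) (by simpa using ha)
  exact (h1.symm.of_abs_le_smul (c := 1) (by simpa using hb)).symm

/-- The vectors disjoint from `z` form a linear subspace. -/
theorem LatDisjoint.span_left {A : Set F} {z x : F} (h : ∀ a ∈ A, LatDisjoint a z)
    (hx : x ∈ Submodule.span ℝ A) : LatDisjoint x z := by
  induction hx using Submodule.span_induction with
  | mem a ha => exact h a ha
  | zero => exact LatDisjoint.zero_left z
  | add x y _ _ hx hy => exact hx.add hy
  | smul c x _ hx => exact hx.smul c

theorem LatDisjoint.span_span {A B : Set F} {x y : F}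
    (h : ∀ a ∈ A, ∀ b ∈ B, LatDisjoint a b) (hx : x ∈ Submodule.span ℝ A)
    (hy : y ∈ Submodule.span ℝ B) : LatDisjoint x y :=
  LatDisjoint.span_left
    (fun a ha => (LatDisjoint.span_left (fun b hb => (h a ha b hb).symm) hy).symm) hx

end VectorLattice

theorem norm_le_norm_of_nonneg_of_le {F : Type*} [NormedAddCommGroup F] [Lattice F]
    [IsOrderedAddMonoid F] [HasSolidNorm F] {a b : F} (ha : 0 ≤ a) (hab : a ≤ b) : ‖a‖ ≤ ‖b‖ :=
  norm_le_norm_of_abs_le_abs (by rwa [abs_of_nonneg ha, abs_of_nonneg (ha.trans hab)])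

/-! ### Order continuous norms and order completeness -/

section OrderContinuous

variable {F : Type u} [NormedAddCommGroup F] [Lattice F]

/-- An order continuous topology, in terms of downward directed sets instead of nets. -/
theorem IsOrderContinuousTopology.exists_mem {t : TopologicalSpace F}
    (ht : IsOrderContinuousTopology t) {D : Set F} (hne : D.Nonempty)
    (hdir : DirectedOn (· ≥ ·) D) (hglb : IsGLB D 0) {U : Set F} (hU : U ∈ @nhds F t 0) :
    ∃ d ∈ D, d ∈ U := by
  have : Nonempty (D)ᵒᵈ := ⟨OrderDual.toDual ⟨hne.choose, hne.choose_spec⟩⟩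
  have : IsDirectedOrder (D)ᵒᵈ := ⟨fun a b => by
    obtain ⟨c, hc, hca, hcb⟩ := hdir _ (OrderDual.ofDual a).2 _ (OrderDual.ofDual b).2
    exact ⟨OrderDual.toDual ⟨c, hc⟩, hca, hcb⟩⟩
  have h := ht (D)ᵒᵈ (fun d => ((OrderDual.ofDual d : D) : F)) (fun a b hab => hab) (by
    have : Set.range (fun d : (D)ᵒᵈ => ((OrderDual.ofDual d : D) : F)) = D := by
      ext x
      exact ⟨fun ⟨d, hd⟩ => hd ▸ (OrderDual.ofDual d).2, fun hx => ⟨OrderDual.toDual ⟨x, hx⟩, rfl⟩⟩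
    rwa [this])
  obtain ⟨d, hd⟩ := (h.eventually hU).exists
  exact ⟨_, (OrderDual.ofDual d).2, hd⟩

theorem HasOrderContinuousNorm.isOrderContinuousTopology (hF : HasOrderContinuousNorm F) :
    IsOrderContinuousTopology (F := F) inferInstance := fun P _ _ _ f hf hglb =>
  tendsto_zero_iff_norm_tendsto_zero.2 (hF P f hf hglb)

theorem HasOrderContinuousNorm.exists_norm_lt (hF : HasOrderContinuousNorm F) {D : Set F}
    (hne : D.Nonempty) (hdir : DirectedOn (· ≥ ·) D) (hglb : IsGLB D 0) {ε : ℝ} (hε : 0 < ε) :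
    ∃ d ∈ D, ‖d‖ < ε := by
  obtain ⟨d, hd, h⟩ := hF.isOrderContinuousTopology.exists_mem hne hdir hglb
    (Metric.ball_mem_nhds (0 : F) hε)
  exact ⟨d, hd, by simpa using h⟩

variable [IsOrderedAddMonoid F]

theorem IsLUB.isGLB_sub {D : Set F} {s : F} (hs : IsLUB D s) :
    IsGLB ((fun d => s - d) '' D) 0 := by
  refine ⟨?_, fun z hz => ?_⟩
  · rintro _ ⟨d, hd, rfl⟩
    exact sub_nonneg.2 (hs.1 hd)
  · have : s ≤ s - z := hs.2 fun d hd => le_sub_comm.1 (hz ⟨d, hd, rfl⟩)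
    simpa using this

/-- In an order continuous topology an upward directed set comes close to its supremum. -/
theorem IsOrderContinuousTopology.exists_sub_mem {t : TopologicalSpace F}
    (ht : IsOrderContinuousTopology t) {D : Set F} (hne : D.Nonempty)
    (hdir : DirectedOn (· ≤ ·) D) {s : F} (hs : IsLUB D s) {U : Set F} (hU : U ∈ @nhds F t 0) :
    ∃ d ∈ D, s - d ∈ U := by
  obtain ⟨_, ⟨d, hd, rfl⟩, h⟩ := ht.exists_mem (hne.image _) (by
    rintro _ ⟨a, ha, rfl⟩ _ ⟨b, hb, rfl⟩
    obtain ⟨c, hc, h1, h2⟩ := hdir a ha b hb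
    exact ⟨_, ⟨c, hc, rfl⟩, sub_le_sub_left h1 s, sub_le_sub_left h2 s⟩) hs.isGLB_sub hU
  exact ⟨d, hd, h⟩

variable [HasSolidNorm F] [NormedSpace ℝ F]

/-- Normed vector lattices are Archimedean, since `n * ‖w‖` is bounded by `‖c‖`. -/
theorem eq_zero_of_forall_nsmul_le {w c : F} (hw : 0 ≤ w) (h : ∀ n : ℕ, n • w ≤ c) : w = 0 := by
  by_contra hne
  have hpos : 0 < ‖w‖ := norm_pos_iff.2 hne
  obtain ⟨n, hn⟩ := exists_nat_gt (‖c‖ / ‖w‖)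
  have h1 := norm_le_norm_of_nonneg_of_le (nsmul_nonneg hw n) (h n)
  rw [← Nat.cast_smul_eq_nsmul ℝ, norm_smul, Real.norm_natCast] at h1
  rw [div_lt_iff₀ hpos] at hn
  linarith

/-- The gaps between the upper bounds of a set `D` and the elements of `D` have infimum zero. -/
theorem isGLB_upperBounds_sub {D : Set F} (hne : D.Nonempty) (hbdd : BddAbove D) :
    IsGLB {x | ∃ u ∈ upperBounds D, ∃ d ∈ D, x = u - d} 0 := by
  obtain ⟨d₀, hd₀⟩ := hne
  obtain ⟨u₀, hu₀⟩ := hbdd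
  refine ⟨?_, fun z hz => ?_⟩
  · rintro _ ⟨u, hu, d, hd, rfl⟩
    exact sub_nonneg.2 (hu hd)
  · have hstep : ∀ u ∈ upperBounds D, u - z ⊔ 0 ∈ upperBounds D := fun u hu d hd => by
      have : z ⊔ 0 ≤ u - d := sup_le (hz ⟨u, hu, d, hd, rfl⟩) (sub_nonneg.2 (hu hd))
      exact le_sub_comm.1 this
    have hn : ∀ n : ℕ, u₀ - n • (z ⊔ 0) ∈ upperBounds D := fun n => by
      induction n with
      | zero => simpa using hu₀
      | succ n ih =>
        rw [succ_nsmul, ← sub_sub]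
        exact hstep _ ih
    have h0 : z ⊔ 0 = 0 := eq_zero_of_forall_nsmul_le (c := u₀ - d₀) le_sup_right
      fun n => le_sub_comm.1 (hn n hd₀)
    exact sup_eq_right.1 h0

variable [CompleteSpace F]

/-- In a Banach lattice with order continuous norm every upward directed set which is bounded above
has a supremum: by `isGLB_upperBounds_sub` the set is a Cauchy net, whose limit is the supremum. -/
theorem HasOrderContinuousNorm.exists_isLUB (hF : HasOrderContinuousNorm F) {D : Set F}
    (hne : D.Nonempty) (hdir : DirectedOn (· ≤ ·) D) (hbdd : BddAbove D) :
    ∃ s, IsLUB D s := by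
  have hE := isGLB_upperBounds_sub hne hbdd
  have hgap : ∀ ε > 0, ∃ u ∈ upperBounds D, ∃ d ∈ D, ‖u - d‖ < ε := fun ε hε => by
    obtain ⟨_, ⟨u, hu, d, hd, rfl⟩, h⟩ := hF.exists_norm_lt
      (D := {x | ∃ u ∈ upperBounds D, ∃ d ∈ D, x = u - d})
      (let ⟨d, hd⟩ := hne; let ⟨u, hu⟩ := hbdd; ⟨u - d, u, hu, d, hd, rfl⟩) (by
        rintro _ ⟨u, hu, d, hd, rfl⟩ _ ⟨u', hu', d', hd', rfl⟩
        obtain ⟨e, he, h1, h2⟩ := hdir d hd d' hd'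
        exact ⟨u ⊓ u' - e, ⟨u ⊓ u', fun x hx => le_inf (hu hx) (hu' hx), e, he, rfl⟩,
          sub_le_sub inf_le_left h1, sub_le_sub inf_le_right h2⟩) hE hε
    exact ⟨u, hu, d, hd, h⟩
  have : Nonempty D := hne.to_subtype
  have : IsDirectedOrder D := ⟨fun a b =>
    let ⟨c, hc, h1, h2⟩ := hdir a a.2 b b.2; ⟨⟨c, hc⟩, h1, h2⟩⟩
  have hcauchy : Cauchy (map (fun d : D => (d : F)) atTop) := by
    refine Metric.cauchy_iff.2 ⟨inferInstance, fun ε hε => ?_⟩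
    obtain ⟨u, hu, d, hd, h⟩ := hgap (ε / 2) (half_pos hε)
    have hclose : ∀ x ∈ D, d ≤ x → ‖x - d‖ < ε / 2 := fun x hx hdx =>
      (norm_le_norm_of_nonneg_of_le (sub_nonneg.2 hdx) (sub_le_sub_right (hu hx) d)).trans_lt h
    refine ⟨_, image_mem_map (Ici_mem_atTop (⟨d, hd⟩ : D)), ?_⟩
    rintro _ ⟨x, hx, rfl⟩ _ ⟨y, hy, rfl⟩
    have h1 := hclose x x.2 hx
    have h2 := hclose y y.2 hy
    rw [← dist_eq_norm] at h1 h2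
    linarith [dist_triangle_right (x : F) y d]
  obtain ⟨s, hs⟩ := CompleteSpace.complete hcauchy
  have hs : Tendsto (fun d : D => (d : F)) atTop (𝓝 s) := hs
  refine ⟨s, fun d hd => ge_of_tendsto hs ?_, fun u hu => le_of_tendsto hs ?_⟩
  · exact (eventually_ge_atTop (⟨d, hd⟩ : D)).mono fun x hx => hx
  · exact Eventually.of_forall fun x => hu x.2

theorem HasOrderContinuousNorm.exists_isLUB_range (hF : HasOrderContinuousNorm F) {u : ℕ → F}
    (hu : Monotone u) {c : F} (hc : ∀ n, u n ≤ c) : ∃ s, IsLUB (Set.range u) s :=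
  hF.exists_isLUB (Set.range_nonempty u) hu.directed_le.directedOn_range
    ⟨c, by rintro _ ⟨n, rfl⟩; exact hc n⟩

theorem HasOrderContinuousNorm.exists_isGLB_range (hF : HasOrderContinuousNorm F) {u : ℕ → F}
    (hu : Antitone u) {c : F} (hc : ∀ n, c ≤ u n) :
    ∃ s, IsGLB (Set.range u) s ∧ ∀ ε > 0, ∃ n, ‖u n - s‖ < ε := by
  obtain ⟨s, hs⟩ := hF.exists_isLUB_range (u := fun n => - u n) hu.neg (c := -c)
    fun n => neg_le_neg (hc n)
  refine ⟨-s, ?_, fun ε hε => ?_⟩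
  · have : Set.range u = -Set.range fun n => - u n := by
      ext x; simp [neg_eq_iff_eq_neg]
    rw [this, isGLB_neg']
    exact hs
  · obtain ⟨_, ⟨n, rfl⟩, h⟩ := hF.isOrderContinuousTopology.exists_sub_mem
      (Set.range_nonempty _) hu.neg.directed_le.directedOn_range hs
      (Metric.ball_mem_nhds (0 : F) hε)
    refine ⟨n, ?_⟩
    rw [mem_ball_zero_iff] at h
    rwa [show u n - -s = s - -u n by abel]

end OrderContinuous

/-! ### Locally solid topologies on order intervals -/

section Amemiya

variable {F : Type u} [NormedAddCommGroup F] [Lattice F]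

/-- A normal sequence of a topology: a sequence of solid neighbourhoods of zero, each of which
contains the sum of the next one with itself. -/
structure IsNormalSeq (t : TopologicalSpace F) (V : ℕ → Set F) : Prop where
  mem : ∀ n, V n ∈ @nhds F t 0
  solid : ∀ n, LatticeOrderedAddCommGroup.IsSolid (V n)
  add : ∀ n x y, x ∈ V (n + 1) → y ∈ V (n + 1) → x + y ∈ V n

variable {t : TopologicalSpace F} {V W : ℕ → Set F}

theorem IsNormalSeq.zero_mem (hV : IsNormalSeq t V) (n : ℕ) : 0 ∈ V n :=
  @mem_of_mem_nhds F t 0 _ (hV.mem n)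

theorem IsNormalSeq.inter (hV : IsNormalSeq t V) (hW : IsNormalSeq t W) :
    IsNormalSeq t fun n => V n ∩ W n where
  mem n := inter_mem (hV.mem n) (hW.mem n)
  solid n _ hx _ hy := ⟨hV.solid n hx.1 hy, hW.solid n hx.2 hy⟩
  add n _ _ hx hy := ⟨hV.add n _ _ hx.1 hy.1, hW.add n _ _ hx.2 hy.2⟩

theorem IsNormalSeq.sum_mem (hV : IsNormalSeq t V) {g : ℕ → F} (hg : ∀ n, g n ∈ V n) (m n : ℕ) :
    ∑ j ∈ Finset.range m, g (n + 1 + j) ∈ V n := by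
  induction m generalizing n with
  | zero => simpa using hV.zero_mem n
  | succ m ih =>
    rw [Finset.sum_range_succ', add_comm]
    refine hV.add n _ _ (hg (n + 1)) ?_
    have := ih (n + 1)
    simpa only [add_assoc, add_comm, add_left_comm] using this

variable [NormedSpace ℝ F]

theorem IsLocallySolidTopology.exists_isNormalSeq (ht : IsLocallySolidTopology t) {U : Set F}
    (hU : U ∈ @nhds F t 0) : ∃ V, IsNormalSeq t V ∧ V 0 ⊆ U := by
  have hstep : ∀ A : {A : Set F // A ∈ @nhds F t 0}, ∃ B : {B : Set F // B ∈ @nhds F t 0},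
      LatticeOrderedAddCommGroup.IsSolid (B : Set F) ∧ (B : Set F) ⊆ A ∧
        ∀ x ∈ (B : Set F), ∀ y ∈ (B : Set F), x + y ∈ (A : Set F) := by
    rintro ⟨A, hA⟩
    have hadd : Tendsto (fun p : F × F => p.1 + p.2) (@nhds F t 0 ×ˢ @nhds F t 0)
        (@nhds F t 0) := by
      have := (@ContinuousAdd.continuous_add F t _ ht.continuousAdd).tendsto (0, 0)
      rw [@nhds_prod_eq F F t t] at this
      simpa using this
    obtain ⟨C, hC, hCA⟩ := mem_prod_same_iff.1 (hadd hA)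
    obtain ⟨B, hB, hBs, hBC⟩ := ht.solid_base _ (inter_mem hC hA)
    exact ⟨⟨B, hB⟩, hBs, fun x hx => (hBC hx).2,
      fun x hx y hy => hCA (Set.mk_mem_prod (hBC hx).1 (hBC hy).1)⟩
  choose f hfs hfA hfadd using hstep
  refine ⟨fun n => (f^[n + 1] ⟨U, hU⟩ : {A : Set F // A ∈ @nhds F t 0}).1, ⟨fun n => Subtype.prop _,
    fun n => ?_, fun n x y hx hy => ?_⟩, hfA _⟩
  · rw [Function.iterate_succ_apply']
    exact hfs _
  · rw [Function.iterate_succ_apply'] at hx hy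
    exact hfadd _ x hx y hy

variable [IsOrderedAddMonoid F] [HasSolidNorm F] [CompleteSpace F]

/-- The elements of `[0, h]` which lie in every set of a normal sequence have a greatest element:
the component of `h` in the null ideal of the sequence. -/
theorem IsNormalSeq.exists_isGreatest (hF : HasOrderContinuousNorm F) (hV : IsNormalSeq t V)
    (hto : IsOrderContinuousTopology t) {h : F} (hh : 0 ≤ h) :
    ∃ b, IsGreatest {g | 0 ≤ g ∧ g ≤ h ∧ ∀ n, g ∈ V n} b := by
  have hne : {g | 0 ≤ g ∧ g ≤ h ∧ ∀ n, g ∈ V n}.Nonempty := ⟨0, le_rfl, hh, hV.zero_mem⟩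
  have hdir : DirectedOn (· ≤ ·) {g | 0 ≤ g ∧ g ≤ h ∧ ∀ n, g ∈ V n} := by
    rintro x ⟨hx, hxh, hxV⟩ y ⟨hy, hyh, hyV⟩
    have hxy : 0 ≤ x ⊔ y := hx.trans le_sup_left
    refine ⟨x ⊔ y, ⟨hxy, sup_le hxh hyh, fun n => ?_⟩, le_sup_left, le_sup_right⟩
    refine hV.solid n (hV.add n x y (hxV _) (hyV _)) ?_
    rw [abs_of_nonneg hxy, abs_of_nonneg (add_nonneg hx hy)]
    exact sup_le (le_add_of_nonneg_right hy) (le_add_of_nonneg_left hx)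
  obtain ⟨b, hb⟩ := hF.exists_isLUB hne hdir ⟨h, fun x hx => hx.2.1⟩
  refine ⟨b, ⟨hb.1 ⟨le_rfl, hh, hV.zero_mem⟩, hb.2 fun x hx => hx.2.1, fun n => ?_⟩, hb.1⟩
  obtain ⟨d, hd, hbd⟩ := hto.exists_sub_mem hne hdir hb (hV.mem (n + 1))
  simpa using hV.add n _ _ hbd (hd.2.2 _)

/-- The components of `h` in the null ideals of all normal sequences decrease to zero when the
topology is Hausdorff, so one of them has small norm. -/
theorem exists_isNormalSeq_norm_lt (hF : HasOrderContinuousNorm F)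
    (hts : IsLocallySolidTopology t) (ht2 : @T2Space F t) (hto : IsOrderContinuousTopology t)
    {h : F} (hh : 0 ≤ h) {ε : ℝ} (hε : 0 < ε) :
    ∃ V, IsNormalSeq t V ∧ ∀ g, 0 ≤ g → g ≤ h → (∀ n, g ∈ V n) → ‖g‖ < ε := by
  -- `D` consists of the components of `h` in the null ideals
  let D : Set F := {b | ∃ V, IsNormalSeq t V ∧ IsGreatest {g | 0 ≤ g ∧ g ≤ h ∧ ∀ n, g ∈ V n} b}
  have hne : D.Nonempty := by
    obtain ⟨V, hV, -⟩ := hts.exists_isNormalSeq univ_mem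
    obtain ⟨b, hb⟩ := hV.exists_isGreatest hF hto hh
    exact ⟨b, V, hV, hb⟩
  have hdir : DirectedOn (· ≥ ·) D := by
    rintro b ⟨V, hV, hb⟩ c ⟨W, hW, hc⟩
    obtain ⟨d, hd⟩ := (hV.inter hW).exists_isGreatest hF hto hh
    exact ⟨d, ⟨_, hV.inter hW, hd⟩, hb.2 ⟨hd.1.1, hd.1.2.1, fun n => (hd.1.2.2 n).1⟩,
      hc.2 ⟨hd.1.1, hd.1.2.1, fun n => (hd.1.2.2 n).2⟩⟩
  have hglb : IsGLB D 0 := by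
    refine ⟨fun b ⟨V, hV, hb⟩ => hb.1.1, fun z hz => ?_⟩
    have hz0 : z ⊔ 0 = 0 := by
      by_contra hne
      have hU : {z ⊔ 0}ᶜ ∈ @nhds F t 0 := by
        let := t
        exact compl_singleton_mem_nhds (Ne.symm hne)
      obtain ⟨V, hV, hVU⟩ := hts.exists_isNormalSeq hU
      obtain ⟨b, hb⟩ := hV.exists_isGreatest hF hto hh
      refine hVU (hV.solid 0 (hb.1.2.2 0) ?_) rfl
      rw [abs_of_nonneg le_sup_right, abs_of_nonneg hb.1.1]
      exact sup_le (hz ⟨V, hV, hb⟩) hb.1.1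
    exact sup_eq_right.1 hz0
  obtain ⟨b, ⟨V, hV, hb⟩, hbε⟩ := hF.exists_norm_lt hne hdir hglb hε
  exact ⟨V, hV, fun g hg hgh hgV =>
    (norm_le_norm_of_nonneg_of_le hg (hb.2 ⟨hg, hgh, hgV⟩)).trans_lt hbε⟩

/-- On order intervals every Hausdorff order continuous locally solid topology is at least as
strong as the norm topology at zero.

If `g n ∈ V n` for a normal sequence `V`, the truncated tail sums `(g (n+1) + ⋯ + g (n+m)) ⊓ h`
increase with `m` to an element `u n` of `V (n-1)` above `g (n+1)`, and `u n` decreases in norm to an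
element of all the `V n`. Its norm is small by the choice of `V`, so that of `g (n+1)` is, too. -/
theorem IsLocallySolidTopology.exists_nhds_norm_lt (hF : HasOrderContinuousNorm F)
    (hts : IsLocallySolidTopology t) (ht2 : @T2Space F t) (hto : IsOrderContinuousTopology t)
    {h : F} (hh : 0 ≤ h) {ε : ℝ} (hε : 0 < ε) :
    ∃ U ∈ @nhds F t 0, LatticeOrderedAddCommGroup.IsSolid U ∧
      ∀ g ∈ U, 0 ≤ g → g ≤ h → ‖g‖ < ε := by
  by_contra! hcon
  obtain ⟨V, hV, hVε⟩ := exists_isNormalSeq_norm_lt hF hts ht2 hto hh (half_pos hε)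
  choose g hgV hg0 hgh hgε using fun n => hcon (V n) (hV.mem n) (hV.solid n)
  -- truncation at `h` keeps the tail sums in `[0, h]`, so no suprema of the `g n` are needed
  let s : ℕ → ℕ → F := fun n m => (∑ j ∈ Finset.range m, g (n + 1 + j)) ⊓ h
  have hsum0 : ∀ n m, 0 ≤ ∑ j ∈ Finset.range m, g (n + 1 + j) := fun n m =>
    Finset.sum_nonneg fun j _ => hg0 _
  have hs0 : ∀ n m, 0 ≤ s n m := fun n m => le_inf (hsum0 n m) hh
  have hsh : ∀ n m, s n m ≤ h := fun n m => inf_le_right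
  have hsV : ∀ n m, s n m ∈ V n := fun n m => by
    refine hV.solid n (hV.sum_mem hgV m n) ?_
    rw [abs_of_nonneg (hs0 n m), abs_of_nonneg (hsum0 n m)]
    exact inf_le_left
  have hsmono : ∀ n, Monotone (s n) := fun n => monotone_nat_of_le_succ fun m =>
    inf_le_inf_right h (by
      rw [Finset.sum_range_succ]
      exact le_add_of_nonneg_right (hg0 _))
  have hsanti : ∀ n m, s (n + 1) m ≤ s n (m + 1) := fun n m => inf_le_inf_right h (by
    rw [Finset.sum_range_succ']
    refine (le_of_eq ?_).trans (le_add_of_nonneg_right (hg0 _))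
    exact Finset.sum_congr rfl fun j _ => by congr 1; ring)
  choose u hu using fun n => hF.exists_isLUB_range (hsmono n) (hsh n)
  have hus : ∀ n m, s n m ≤ u n := fun n m => (hu n).1 ⟨m, rfl⟩
  have hu0 : ∀ n, 0 ≤ u n := fun n => (hs0 n 0).trans (hus n 0)
  have huh : ∀ n, u n ≤ h := fun n => (hu n).2 (by rintro _ ⟨m, rfl⟩; exact hsh n m)
  have huV : ∀ n, u (n + 1) ∈ V n := fun n => by
    obtain ⟨_, ⟨m, rfl⟩, hm⟩ := hto.exists_sub_mem (Set.range_nonempty _)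
      (hsmono (n + 1)).directed_le.directedOn_range (hu (n + 1)) (hV.mem (n + 1))
    simpa using hV.add n _ _ hm (hsV (n + 1) m)
  have hgu : ∀ n, g (n + 1) ≤ u n := fun n => by
    have : s n 1 = g (n + 1) := by simpa [s] using hgh (n + 1)
    exact this ▸ hus n 1
  have huanti : Antitone u := antitone_nat_of_succ_le fun n =>
    (hu (n + 1)).2 (by rintro _ ⟨m, rfl⟩; exact (hsanti n m).trans (hus n _))
  obtain ⟨w, hw, hwu⟩ := hF.exists_isGLB_range huanti hu0
  have hwle : ∀ n, w ≤ u n := fun n => hw.1 ⟨n, rfl⟩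
  have hw0 : 0 ≤ w := hw.2 (by rintro _ ⟨n, rfl⟩; exact hu0 n)
  have hwV : ∀ n, w ∈ V n := fun n => hV.solid n (huV n) (by
    rw [abs_of_nonneg hw0, abs_of_nonneg (hu0 _)]
    exact hwle _)
  have hwε := hVε w hw0 ((hwle 0).trans (huh 0)) hwV
  obtain ⟨n, hn⟩ := hwu (ε / 2) (half_pos hε)
  have h1 := norm_le_norm_of_nonneg_of_le (hg0 (n + 1)) (hgu n)
  have h2 := hgε (n + 1)
  have h3 := norm_sub_norm_le (u n) w
  linarith

end Amemiya

/-! ### The un- and uaw-topologies -/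

/-- Convergence in the translation invariant topology defined by a family of subadditive
functions. -/
theorem tendsto_nhds_generateFrom_subadditive {E ι α : Type*} [AddCommGroup E] {ρ : ι → E → ℝ}
    (hnonneg : ∀ i x, 0 ≤ ρ i x) (hzero : ∀ i, ρ i 0 = 0)
    (hadd : ∀ i x y, ρ i (x + y) ≤ ρ i x + ρ i y) {l : Filter α} {f : α → E} {a : E} :
    Tendsto f l (@nhds E (TopologicalSpace.generateFrom
      {U | ∃ i f, ∃ ε : ℝ, 0 < ε ∧ U = {g | ρ i (g - f) < ε}}) a) ↔
      ∀ i, Tendsto (fun p => ρ i (f p - a)) l (𝓝 0) := by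
  rw [TopologicalSpace.tendsto_nhds_generateFrom_iff]
  constructor
  · intro h i
    rw [(nhds_basis_Ioo_pos (0 : ℝ)).tendsto_right_iff]
    intro ε hε
    have := h _ ⟨i, a, ε, hε, rfl⟩ (by simpa [hzero] using hε)
    filter_upwards [this] with p hp
    have hp : ρ i (f p - a) < ε := hp
    exact ⟨by linarith [hnonneg i (f p - a)], by linarith⟩
  · rintro h _ ⟨i, c, ε, hε, rfl⟩ ha
    have ha : ρ i (a - c) < ε := ha
    filter_upwards [(h i).eventually_lt_const (sub_pos.2 ha)] with p hp
    have := hadd i (f p - a) (a - c)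
    rw [sub_add_sub_cancel] at this
    change ρ i (f p - c) < ε
    linarith

section UnTopologies

variable {F : Type u} [NormedAddCommGroup F] [Lattice F]

theorem unTopology_eq : unTopology F = TopologicalSpace.generateFrom
    {U | ∃ (i : {h : F // 0 ≤ h}) (f : F), ∃ ε : ℝ, 0 < ε ∧
      U = {g | ‖|g - f| ⊓ (i : F)‖ < ε}} := by
  unfold unTopology
  congr 1
  ext U
  constructor
  · rintro ⟨h, f, ε, hh, hε, rfl⟩
    exact ⟨⟨h, hh⟩, f, ε, hε, rfl⟩
  · rintro ⟨⟨h, hh⟩, f, ε, hε, rfl⟩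
    exact ⟨h, f, ε, hh, hε, rfl⟩

theorem tendsto_nhds_unTopology [IsOrderedAddMonoid F] [HasSolidNorm F] {α : Type*}
    {l : Filter α} {f : α → F} {a : F} :
    Tendsto f l (@nhds F (unTopology F) a) ↔
      ∀ h : F, 0 ≤ h → Tendsto (fun p => ‖|f p - a| ⊓ h‖) l (𝓝 0) := by
  rw [unTopology_eq, tendsto_nhds_generateFrom_subadditive
    (ρ := fun (i : {h : F // 0 ≤ h}) (x : F) => ‖|x| ⊓ (i : F)‖)]
  · exact ⟨fun H h hh => H ⟨h, hh⟩, fun H i => H i i.2⟩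
  · exact fun i x => norm_nonneg _
  · intro i
    simp [i.2]
  · intro i x y
    exact (norm_le_norm_of_nonneg_of_le (le_inf (abs_nonneg _) i.2)
      (abs_add_inf_le x y i.2)).trans (norm_add_le _ _)

variable [NormedSpace ℝ F]

theorem uawTopology_eq : uawTopology F = TopologicalSpace.generateFrom
    {U | ∃ (i : {h : F // 0 ≤ h} × {ν : F →L[ℝ] ℝ // ∀ x : F, 0 ≤ x → 0 ≤ ν x}) (f : F),
      ∃ ε : ℝ, 0 < ε ∧ U = {g | (i.2 : F →L[ℝ] ℝ) (|g - f| ⊓ (i.1 : F)) < ε}} := by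
  unfold uawTopology
  congr 1
  ext U
  constructor
  · rintro ⟨h, f, ν, ε, hh, hν, hε, rfl⟩
    exact ⟨⟨⟨h, hh⟩, ν, hν⟩, f, ε, hε, rfl⟩
  · rintro ⟨⟨⟨h, hh⟩, ν, hν⟩, f, ε, hε, rfl⟩
    exact ⟨h, f, ν, ε, hh, hν, hε, rfl⟩

theorem map_le_map_of_le_of_nonneg [IsOrderedAddMonoid F] {ν : F →L[ℝ] ℝ}
    (hν : ∀ x : F, 0 ≤ x → 0 ≤ ν x) {x y : F} (h : x ≤ y) : ν x ≤ ν y := by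
  have := hν _ (sub_nonneg.2 h)
  rw [map_sub] at this
  linarith

variable [IsOrderedAddMonoid F]

theorem tendsto_nhds_uawTopology {α : Type*} {l : Filter α} {f : α → F} {a : F} :
    Tendsto f l (@nhds F (uawTopology F) a) ↔ ∀ h : F, 0 ≤ h → ∀ ν : F →L[ℝ] ℝ,
      (∀ x : F, 0 ≤ x → 0 ≤ ν x) → Tendsto (fun p => ν (|f p - a| ⊓ h)) l (𝓝 0) := by
  rw [uawTopology_eq, tendsto_nhds_generateFrom_subadditive
    (ρ := fun (i : {h : F // 0 ≤ h} × {ν : F →L[ℝ] ℝ // ∀ x : F, 0 ≤ x → 0 ≤ ν x}) (x : F) =>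
      (i.2 : F →L[ℝ] ℝ) (|x| ⊓ (i.1 : F)))]
  · exact ⟨fun H h hh ν hν => H ⟨⟨h, hh⟩, ν, hν⟩, fun H i => H i.1 i.1.2 i.2 i.2.2⟩
  · exact fun i x => i.2.2 _ (le_inf (abs_nonneg x) i.1.2)
  · intro i
    simp [i.1.2]
  · intro i x y
    rw [← map_add]
    exact map_le_map_of_le_of_nonneg i.2.2 (abs_add_inf_le x y i.1.2)

theorem isLocallySolidTopology_uawTopology [IsOrderedModule ℝ F] :
    IsLocallySolidTopology (uawTopology F) where
  continuousAdd := by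
    let := uawTopology F
    refine ⟨continuous_iff_continuousAt.2 fun ⟨a, b⟩ => ?_⟩
    refine tendsto_nhds_uawTopology.2 fun h hh ν hν => ?_
    have ha := tendsto_nhds_uawTopology.1 (continuous_fst.tendsto (a, b)) h hh ν hν
    have hb := tendsto_nhds_uawTopology.1 (continuous_snd.tendsto (a, b)) h hh ν hν
    refine squeeze_zero (fun g => hν _ (le_inf (abs_nonneg _) hh)) (fun p => ?_)
      (by simpa using ha.add hb)
    rw [← map_add]
    refine map_le_map_of_le_of_nonneg hν ?_
    have := abs_add_inf_le (p.1 - a) (p.2 - b) hh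
    rwa [← add_sub_add_comm] at this
  continuousSMul := by
    let := uawTopology F
    refine ⟨continuous_iff_continuousAt.2 fun ⟨c, a⟩ => ?_⟩
    refine tendsto_nhds_uawTopology.2 fun h hh ν hν => ?_
    have ha := tendsto_nhds_uawTopology.1 (continuous_snd.tendsto (c, a)) h hh ν hν
    have hc : Tendsto (fun p : ℝ × F => |p.1 - c|) (𝓝 (c, a)) (𝓝 0) := by
      have : Continuous fun p : ℝ × F => |p.1 - c| := (continuous_fst.sub continuous_const).abs
      simpa using this.tendsto (c, a)
    have hbound : ∀ᶠ p : ℝ × F in 𝓝 (c, a), |p.1 - c| < 1 := hc.eventually_lt_const one_pos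
    refine squeeze_zero' (Eventually.of_forall fun g => hν _ (le_inf (abs_nonneg _) hh)) ?_
      (g := fun p => (|c| + 1) * ν (|p.2 - a| ⊓ h) + |p.1 - c| * ν |a|)
      (by simpa using (ha.const_mul (|c| + 1)).add (hc.mul_const (ν |a|)))
    filter_upwards [hbound] with p hp
    have hpc : |p.1| ≤ |c| + 1 := by
      have := abs_add_le (p.1 - c) c
      rw [sub_add_cancel] at this
      linarith
    have h1 : |p.1 • p.2 - c • a| ⊓ h ≤
        (|c| + 1) • (|p.2 - a| ⊓ h) + |p.1 - c| • |a| := by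
      have e : p.1 • p.2 - c • a = p.1 • (p.2 - a) + (p.1 - c) • a := by
        rw [smul_sub, sub_smul]; abel
      rw [e]
      refine (abs_add_inf_le _ _ hh).trans (add_le_add ?_ (inf_le_left.trans (abs_smul_le _ _)))
      refine le_trans (inf_le_inf_right h ((abs_smul_le _ _).trans
        (smul_le_smul_of_nonneg_right hpc (abs_nonneg _)))) ?_
      exact smul_inf_le_smul_inf (by linarith [abs_nonneg c]) _ hh
    have h2 := map_le_map_of_le_of_nonneg hν h1
    simpa using h2
  solid_base U hU := by
    -- the solid core of `U` is a neighbourhood of zero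
    refine ⟨{x | ∀ y, |y| ≤ |x| → y ∈ U}, ?_, fun x hx y hy z hz => hx z (hz.trans hy),
      fun x hx => hx x le_rfl⟩
    by_contra hcon
    let l := @nhds F (uawTopology F) 0 ⊓ 𝓟 {x | ∀ y, |y| ≤ |x| → y ∈ U}ᶜ
    have : l.NeBot := ⟨fun h => hcon (mem_iff_inf_principal_compl.2 h)⟩
    have hex : ∀ x : F, ∃ y, |y| ≤ |x| ∧ (x ∈ {x | ∀ y, |y| ≤ |x| → y ∈ U}ᶜ → y ∉ U) := by
      intro x
      by_cases hx : ∀ y, |y| ≤ |x| → y ∈ U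
      · exact ⟨x, le_rfl, fun h => absurd hx h⟩
      · push Not at hx
        obtain ⟨y, hy, hyU⟩ := hx
        exact ⟨y, hy, fun _ => hyU⟩
    choose y hy hyU using hex
    -- `y` inherits convergence to zero from the identity but avoids `U` along `l`
    have hlim : Tendsto y l (@nhds F (uawTopology F) 0) := by
      refine tendsto_nhds_uawTopology.2 fun h hh ν hν => ?_
      have hid := tendsto_nhds_uawTopology.1 (tendsto_id'.2 (inf_le_left : l ≤ _)) h hh ν hν
      refine squeeze_zero (fun g => hν _ (le_inf (abs_nonneg _) hh)) (fun x => ?_) hid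
      refine map_le_map_of_le_of_nonneg hν (inf_le_inf_right h ?_)
      simpa using hy x
    obtain ⟨x, hxU, hx⟩ := ((hlim.eventually hU).and
      (mem_inf_of_right (mem_principal_self _))).exists
    exact hyU x hx hxU

variable [HasSolidNorm F]

theorem unTopology_le_uawTopology : unTopology F ≤ uawTopology F := by
  refine le_of_nhds_le_nhds fun a => ?_
  refine tendsto_id'.1 (tendsto_nhds_uawTopology.2 fun h hh ν hν => ?_)
  have h1 := tendsto_nhds_unTopology.1 (tendsto_id (x := @nhds F (unTopology F) a)) h hh
  refine squeeze_zero (fun g => hν _ (le_inf (abs_nonneg _) hh)) (fun g => ?_)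
    (by simpa using h1.const_mul ‖ν‖)
  exact (le_abs_self _).trans (ν.le_opNorm _)

theorem isOrderContinuousTopology_uawTopology (hF : HasOrderContinuousNorm F) :
    IsOrderContinuousTopology (uawTopology F) := fun P _ _ _ f hf hglb => by
  refine tendsto_nhds_uawTopology.2 fun h hh ν hν => ?_
  refine squeeze_zero (fun g => hν _ (le_inf (abs_nonneg _) hh)) (fun p => ?_)
    (by simpa using (hF P f hf hglb).const_mul ‖ν‖)
  rw [sub_zero]
  calc ν (|f p| ⊓ h) ≤ ν |f p| := map_le_map_of_le_of_nonneg hν inf_le_left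
    _ ≤ ‖ν‖ * ‖|f p|‖ := (le_abs_self _).trans (ν.le_opNorm _)
    _ = ‖ν‖ * ‖f p‖ := by rw [norm_abs_eq_norm]

/-- The un-topology is weaker than every Hausdorff order continuous locally solid topology. -/
theorem le_unTopology [CompleteSpace F] (hF : HasOrderContinuousNorm F) {t : TopologicalSpace F}
    (hts : IsLocallySolidTopology t) (ht2 : @T2Space F t) (hto : IsOrderContinuousTopology t) :
    t ≤ unTopology F := by
  refine le_of_nhds_le_nhds fun a => ?_
  refine tendsto_id'.1 (tendsto_nhds_unTopology.2 fun h hh => ?_)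
  have htr : Tendsto (fun g => g - a) (@nhds F t a) (@nhds F t 0) := by
    let := t
    have := hts.continuousAdd
    have h1 : Continuous fun g : F => g + -a := continuous_add_const (-a)
    simpa [sub_eq_add_neg] using h1.tendsto a
  rw [(nhds_basis_Ioo_pos (0 : ℝ)).tendsto_right_iff]
  intro ε hε
  obtain ⟨U, hU, hUs, hUε⟩ := hts.exists_nhds_norm_lt hF ht2 hto hh hε
  filter_upwards [htr hU] with g hg
  have h0 : 0 ≤ |g - a| ⊓ h := le_inf (abs_nonneg _) hh
  have := hUε (|g - a| ⊓ h) (hUs hg (by rw [abs_of_nonneg h0]; exact inf_le_left)) h0 inf_le_right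
  exact ⟨lt_of_lt_of_le (by linarith) (norm_nonneg _), by simpa using this⟩

variable [IsOrderedModule ℝ F]

/-- Positive functionals separate the points of the positive cone from zero, by the Hahn-Banach
theorem applied to the closed positive cone. -/
theorem exists_nonneg_functional_pos {x : F} (hx : 0 < x) :
    ∃ ν : F →L[ℝ] ℝ, (∀ y : F, 0 ≤ y → 0 ≤ ν y) ∧ 0 < ν x := by
  have hconv : Convex ℝ {y : F | 0 ≤ y} := convex_Ici (𝕜 := ℝ) (0 : F)
  have hnot : -x ∉ {y : F | 0 ≤ y} := fun h => (neg_nonneg.1 h).not_gt hx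
  obtain ⟨ν, c, hc, hν⟩ := geometric_hahn_banach_point_closed hconv isClosed_nonneg hnot
  have hc0 : c < 0 := by simpa using hν 0 (show (0 : F) ≤ 0 from le_rfl)
  refine ⟨ν, fun y hy => ?_, ?_⟩
  · by_contra! hlt
    -- a negative value on the cone could be scaled to lie below `c`
    have h1 := hν ((c / ν y) • y) (show (0 : F) ≤ (c / ν y) • y from
      smul_nonneg (div_nonneg_of_nonpos hc0.le hlt.le) hy)
    rw [map_smul, smul_eq_mul, div_mul_cancel₀ _ hlt.ne] at h1
    exact lt_irrefl _ h1
  · rw [map_neg] at hc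
    linarith

theorem t2Space_uawTopology : @T2Space F (uawTopology F) := by
  let := uawTopology F
  refine t2_iff_nhds.2 fun {x y} hne => ?_
  by_contra hxy
  have hpos : 0 < |x - y| :=
    lt_of_le_of_ne (abs_nonneg _) fun h => hxy (sub_eq_zero.1 (by
      have h1 := neg_le_abs (x - y)
      have h2 := le_abs_self (x - y)
      rw [← h] at h1 h2
      exact le_antisymm h2 (by simpa using h1)))
  obtain ⟨ν, hν, hνpos⟩ := exists_nonneg_functional_pos hpos
  have hlim : ∀ z : F, 𝓝 x ⊓ 𝓝 y ≤ 𝓝 z →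
      Tendsto (fun g => ν (|g - z| ⊓ |x - y|)) (𝓝 x ⊓ 𝓝 y) (𝓝 0) := fun z hz =>
    tendsto_nhds_uawTopology.1 (tendsto_id'.2 hz) _ hpos.le ν hν
  have h0 : Tendsto (fun g => ν (|g - x| ⊓ |x - y|) + ν (|g - y| ⊓ |x - y|)) (𝓝 x ⊓ 𝓝 y)
      (𝓝 0) := by
    simpa using (hlim x inf_le_left).add (hlim y inf_le_right)
  refine hνpos.not_ge (ge_of_tendsto h0 (Eventually.of_forall fun g => ?_))
  rw [← map_add]
  refine map_le_map_of_le_of_nonneg hν ?_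
  have := abs_add_inf_le (g - y) (-(g - x)) (abs_nonneg (x - y))
  rw [abs_neg, show g - y + -(g - x) = x - y by abel, inf_idem, add_comm] at this
  exact this

variable [CompleteSpace F]

theorem unTopology_eq_uawTopology (hF : HasOrderContinuousNorm F) :
    unTopology F = uawTopology F :=
  le_antisymm unTopology_le_uawTopology (le_unTopology hF isLocallySolidTopology_uawTopology
    t2Space_uawTopology (isOrderContinuousTopology_uawTopology hF))

theorem isMinimalHausdorffOrderContinuous_unTopology (hF : HasOrderContinuousNorm F) :
    IsMinimalHausdorffOrderContinuous (unTopology F) := by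
  refine ⟨?_, fun t ht => le_unTopology hF ht.1 ht.2.1 ht.2.2⟩
  rw [unTopology_eq_uawTopology hF]
  exact ⟨isLocallySolidTopology_uawTopology, t2Space_uawTopology,
    isOrderContinuousTopology_uawTopology hF⟩

end UnTopologies

/-! ### Disjoint tuples and sequences of unit vectors -/

section Domination

variable {F : Type u} [NormedAddCommGroup F] [Lattice F] [IsOrderedAddMonoid F] [HasSolidNorm F]
  [NormedSpace ℝ F] [IsOrderedModule ℝ F] [CompleteSpace F]

/-- On `[0, h]` a single positive functional controls the norm. This reformulates the coincidence of
the un- and uaw-topologies: otherwise the elements of `[0, h]` of norm at least `ε` would contain a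
uaw-null net. -/
theorem exists_functional_le_of_norm_ge (hF : HasOrderContinuousNorm F) {h : F} (hh : 0 ≤ h) {ε : ℝ}
    (hε : 0 < ε) : ∃ ν : F →L[ℝ] ℝ, (∀ x : F, 0 ≤ x → 0 ≤ ν x) ∧ ∃ δ > 0,
      ∀ g, 0 ≤ g → g ≤ h → ε ≤ ‖g‖ → δ ≤ ν g := by
  by_contra! hcon
  -- the sets of counterexamples for `ν` and `δ` form a filter base, directed by adding functionals
  let ι := {ν : F →L[ℝ] ℝ // ∀ x : F, 0 ≤ x → 0 ≤ ν x} × {δ : ℝ // 0 < δ}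
  let s : ι → Set F := fun i => {g | 0 ≤ g ∧ g ≤ h ∧ ε ≤ ‖g‖ ∧ (i.1 : F →L[ℝ] ℝ) g < i.2}
  have hne : ∀ i, (s i).Nonempty := fun i => hcon i.1 i.1.2 i.2 i.2.2
  have hdir : Directed (· ≥ ·) fun i => 𝓟 (s i) := by
    rintro ⟨⟨ν, hν⟩, δ, hδ⟩ ⟨⟨ν', hν'⟩, δ', hδ'⟩
    refine ⟨⟨⟨ν + ν', fun x hx => add_nonneg (hν x hx) (hν' x hx)⟩, min δ δ', lt_min hδ hδ'⟩,
      principal_mono.2 ?_, principal_mono.2 ?_⟩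
    · rintro g ⟨h1, h2, h3, h4⟩
      have h4 : ν g + ν' g < min δ δ' := h4
      exact ⟨h1, h2, h3, show ν g < δ by linarith [hν' g h1, min_le_left δ δ']⟩
    · rintro g ⟨h1, h2, h3, h4⟩
      have h4 : ν g + ν' g < min δ δ' := h4
      exact ⟨h1, h2, h3, show ν' g < δ' by linarith [hν g h1, min_le_right δ δ']⟩
  have : Nonempty ι := ⟨⟨⟨0, fun _ _ => le_rfl⟩, 1, one_pos⟩⟩
  let l : Filter F := ⨅ i, 𝓟 (s i)
  have : l.NeBot := iInf_neBot_of_directed hdir fun i => principal_neBot_iff.2 (hne i)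
  have hs : ∀ i, s i ∈ l := fun i => mem_iInf_of_mem i (mem_principal_self _)
  have hun : Tendsto id l (@nhds F (unTopology F) 0) := by
    rw [unTopology_eq_uawTopology hF]
    refine tendsto_nhds_uawTopology.2 fun k hk ν hν => ?_
    rw [(nhds_basis_Ioo_pos (0 : ℝ)).tendsto_right_iff]
    intro δ hδ
    filter_upwards [hs ⟨⟨ν, hν⟩, δ, hδ⟩] with g hg
    have h1 : ν (|g - 0| ⊓ k) ≤ ν g := by
      rw [sub_zero, abs_of_nonneg hg.1]
      exact map_le_map_of_le_of_nonneg hν inf_le_left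
    have h2 : ν g < δ := hg.2.2.2
    exact ⟨lt_of_lt_of_le (by linarith) (hν _ (le_inf (abs_nonneg _) hk)),
      lt_of_le_of_lt h1 (by linarith)⟩
  have hlt := (tendsto_nhds_unTopology.1 hun h hh).eventually_lt_const hε
  obtain ⟨g, hgε, hg⟩ := (hlt.and (hs (Classical.arbitrary ι))).exists
  rw [id, sub_zero, abs_of_nonneg hg.1, inf_eq_left.2 hg.2.1] at hgε
  exact hgε.not_ge hg.2.2.1

/-- A long disjoint tuple in an order interval contains an element of small norm. -/
theorem exists_forall_disjoint_norm_lt (hF : HasOrderContinuousNorm F) {h : F} (hh : 0 ≤ h) {ε : ℝ}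
    (hε : 0 < ε) : ∃ N : ℕ, ∀ n ≥ N, ∀ g : Fin n → F, (∀ i, 0 ≤ g i) → (∀ i, g i ≤ h) →
      Pairwise (fun i j => LatDisjoint (g i) (g j)) → ∃ i, ‖g i‖ < ε := by
  obtain ⟨ν, hν, δ, hδ, hνδ⟩ := exists_functional_le_of_norm_ge hF hh hε
  obtain ⟨N, hN⟩ := exists_nat_gt (ν h / δ)
  refine ⟨N, fun n hn g hg hgh hd => ?_⟩
  by_contra! hcon
  have h1 : (n : ℝ) * δ ≤ ν h := by
    calc (n : ℝ) * δ = ∑ i : Fin n, δ := by simp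
      _ ≤ ∑ i, ν (g i) := Finset.sum_le_sum fun i _ => hνδ _ (hg i) (hgh i) (hcon i)
      _ = ν (∑ i, g i) := (map_sum ν g _).symm
      _ ≤ ν h := map_le_map_of_le_of_nonneg hν (sum_le_of_pairwise_latDisjoint _ hh hg hgh hd)
  rw [div_lt_iff₀ hδ] at hN
  have : (N : ℝ) * δ ≤ n * δ := mul_le_mul_of_nonneg_right (by exact_mod_cast hn) hδ.le
  linarith

/-- Countably many vectors lie in the ideal generated by a single positive vector. -/
theorem exists_forall_abs_le_smul {ι : Type*} [Countable ι] (x : ι → F) :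
    ∃ e : F, 0 ≤ e ∧ ∀ i, ∃ C : ℝ, |x i| ≤ C • e := by
  rcases isEmpty_or_nonempty ι with hι | hι
  · exact ⟨0, le_rfl, fun i => hι.elim i⟩
  obtain ⟨q, hq⟩ := exists_surjective_nat ι
  let c : ℕ → ℝ := fun k => (1 / 2) ^ k * (1 + ‖x (q k)‖)⁻¹
  have hc : ∀ k, 0 < c k := fun k => by positivity
  have hsum : Summable fun k => c k • |x (q k)| := by
    refine Summable.of_norm_bounded summable_geometric_two fun k => ?_
    rw [norm_smul, norm_abs_eq_norm, Real.norm_of_nonneg (hc k).le, mul_assoc]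
    refine mul_le_of_le_one_right (by positivity) ?_
    rw [inv_mul_le_iff₀ (by positivity)]
    linarith
  have hnn : ∀ k, 0 ≤ c k • |x (q k)| := fun k => smul_nonneg (hc k).le (abs_nonneg _)
  refine ⟨∑' k, c k • |x (q k)|, tsum_nonneg hnn, fun i => ?_⟩
  obtain ⟨k, rfl⟩ := hq i
  refine ⟨(c k)⁻¹, ?_⟩
  rw [le_inv_smul_iff_of_pos (hc k)]
  exact hsum.le_tsum k fun j _ => hnn j

/-- In the ideal generated by `e`, un-convergence to zero can be tested against `e` alone. -/
theorem tendsto_unTopology_of_tendsto_inf (hF : HasOrderContinuousNorm F) {e : F} (he : 0 ≤ e)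
    {f : ℕ → F} (hfe : ∀ k, ∃ C : ℝ, |f k| ≤ C • e)
    (hlim : Tendsto (fun k => ‖|f k| ⊓ e‖) atTop (𝓝 0)) :
    Tendsto f atTop (@nhds F (unTopology F) 0) := by
  refine tendsto_nhds_unTopology.2 fun h hh => ?_
  simp only [sub_zero]
  have hmono : Monotone fun n : ℕ => h ⊓ (n : ℝ) • e := fun a b hab =>
    inf_le_inf_left h (smul_le_smul_of_nonneg_right (by exact_mod_cast hab) he)
  -- `s` is the component of `h` in the band of `e`; on the ideal of `e` it can replace `h`
  obtain ⟨s, hs⟩ := hF.exists_isLUB_range hmono fun n => inf_le_left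
  have hsn : ∀ n : ℕ, h ⊓ (n : ℝ) • e ≤ s := fun n => hs.1 ⟨n, rfl⟩
  rw [(nhds_basis_Ioo_pos (0 : ℝ)).tendsto_right_iff]
  intro ε hε
  obtain ⟨_, ⟨n, rfl⟩, hn⟩ := hF.isOrderContinuousTopology.exists_sub_mem (Set.range_nonempty _)
    hmono.directed_le.directedOn_range hs (Metric.ball_mem_nhds (0 : F) (half_pos hε))
  rw [mem_ball_zero_iff] at hn
  have hlim' : Tendsto (fun k => ((n : ℝ) + 1) * ‖|f k| ⊓ e‖) atTop (𝓝 0) := by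
    simpa using hlim.const_mul ((n : ℝ) + 1)
  filter_upwards [hlim'.eventually_lt_const (half_pos hε)] with k hk
  have hle : |f k| ⊓ h ≤ ((n : ℝ) + 1) • (|f k| ⊓ e) + (s - h ⊓ (n : ℝ) • e) := by
    have h1 : |f k| ⊓ h ≤ s := by
      obtain ⟨C, hC⟩ := hfe k
      obtain ⟨m, hm⟩ := exists_nat_ge C
      refine le_trans (le_inf inf_le_right (inf_le_left.trans (hC.trans ?_))) (hsn m)
      exact smul_le_smul_of_nonneg_right hm he
    have h2 : |f k| ⊓ h ≤ (h ⊓ (n : ℝ) • e + (s - h ⊓ (n : ℝ) • e)) ⊓ |f k| := by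
      rw [add_sub_cancel]
      exact le_inf h1 inf_le_left
    refine h2.trans ((add_inf_le (le_inf hh (smul_nonneg n.cast_nonneg he))
      (sub_nonneg.2 (hsn n)) (abs_nonneg _)).trans (add_le_add ?_ inf_le_left))
    calc (h ⊓ (n : ℝ) • e) ⊓ |f k| ≤ (((n : ℝ) + 1) • e) ⊓ |f k| :=
          inf_le_inf_right _ (inf_le_right.trans
            (smul_le_smul_of_nonneg_right (by linarith) he))
      _ ≤ ((n : ℝ) + 1) • (e ⊓ |f k|) :=
          smul_inf_le_smul_inf (by linarith [(n.cast_nonneg : (0 : ℝ) ≤ n)]) _ (abs_nonneg _)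
      _ = ((n : ℝ) + 1) • (|f k| ⊓ e) := by rw [inf_comm]
  have h3 := (norm_le_norm_of_nonneg_of_le (le_inf (abs_nonneg _) hh) hle).trans (norm_add_le _ _)
  rw [norm_smul, Real.norm_of_nonneg (by positivity)] at h3
  exact ⟨lt_of_lt_of_le (by linarith) (norm_nonneg _), by linarith⟩

variable {H : Type v} [NormedAddCommGroup H] [NormedSpace ℝ H]

/-- If `T` is not `n`-DNS for any `n`, there are disjoint `n`-tuples of unit vectors on which `T` is
arbitrarily small. All of them lie in the ideal of one vector `e`, and in each long tuple some
entry is almost disjoint from `e`, so these entries form a un-null sequence. -/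
theorem SeqComplements.exists_isNDNS (hF : HasOrderContinuousNorm F) {T : F →L[ℝ] H}
    (hT : SeqComplements T (unTopology F)) : ∃ n : ℕ, 2 ≤ n ∧ IsNDNS n T := by
  by_contra! hcon
  have hex : ∀ n : ℕ, ∃ f : Fin (n + 2) → F, Pairwise (fun i j => LatDisjoint (f i) (f j)) ∧
      ∀ k, ‖f k‖ = 1 ∧ ‖T (f k)‖ ≤ 1 / ((n : ℝ) + 1) := fun n => by
    by_contra hn
    exact hcon (n + 2) (by omega) ⟨1 / ((n : ℝ) + 1), by positivity, hn⟩
  choose f hfd hf using hex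
  obtain ⟨e, he, hfe⟩ := exists_forall_abs_le_smul fun p : Σ n, Fin (n + 2) => f p.1 p.2
  have hsel : ∀ m : ℕ, ∃ p : Σ n, Fin (n + 2), m ≤ p.1 ∧
      ‖|f p.1 p.2| ⊓ e‖ < 1 / ((m : ℝ) + 1) := fun m => by
    obtain ⟨N, hN⟩ := exists_forall_disjoint_norm_lt hF he
      (show (0 : ℝ) < 1 / ((m : ℝ) + 1) by positivity)
    obtain ⟨i, hi⟩ := hN (max m N + 2) (by have := le_max_right m N; omega)
      (fun i => |f (max m N) i| ⊓ e) (fun i => le_inf (abs_nonneg _) he) (fun i => inf_le_right)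
      fun i j hij => (hfd _ hij).mono
        (by rw [abs_of_nonneg (le_inf (abs_nonneg _) he)]; exact inf_le_left)
        (by rw [abs_of_nonneg (le_inf (abs_nonneg _) he)]; exact inf_le_left)
    exact ⟨⟨max m N, i⟩, le_max_left _ _, hi⟩
  choose p hpm hp using hsel
  refine hT ⟨fun m => f (p m).1 (p m).2, fun m => (hf _ _).1, ?_, ?_⟩
  · refine tendsto_unTopology_of_tendsto_inf hF he (fun m => hfe (p m)) ?_
    exact squeeze_zero (fun m => norm_nonneg _) (fun m => (hp m).le)
      tendsto_one_div_add_atTop_nhds_zero_nat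
  · refine squeeze_zero (fun m => norm_nonneg _) (fun m => ((hf _ _).2.trans ?_))
      tendsto_one_div_add_atTop_nhds_zero_nat
    exact one_div_le_one_div_of_le (by positivity) (by have := hpm m; gcongr)

end Domination

/-! ### Extracting disjoint sequences -/

section KadecPelczynski

section LatticeGroup

variable {F : Type*} [AddCommGroup F] [Lattice F]

/-- The excess of `f` over the order interval `[-b, b]`: the difference between `f` and its truncation
to that interval. -/
def excess (f b : F) : F := f - (f ⊓ b) ⊔ (-b)

variable [IsOrderedAddMonoid F]

theorem abs_sub_excess_le (f : F) {b : F} (hb : 0 ≤ b) : |f - excess f b| ≤ |f| ⊓ b := by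
  have e : f - excess f b = (f ⊓ b) ⊔ (-b) := by simp [excess]
  rw [e]
  have hb' : -b ≤ 0 := neg_nonpos.2 hb
  have hneg : -|f| ≤ f := neg_le.1 (neg_le_abs f)
  refine abs_le'.2 ⟨sup_le (inf_le_inf_right b (le_abs_self f))
    (hb'.trans (le_inf (abs_nonneg f) hb)), le_inf (neg_le.1 ?_) (neg_le.1 le_sup_right)⟩
  exact (le_inf hneg ((neg_nonpos.2 (abs_nonneg f)).trans hb)).trans le_sup_left

theorem abs_excess_le (f b : F) : |excess f b| ≤ (|f| - b) ⊔ 0 := by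
  refine abs_le'.2 ⟨?_, ?_⟩
  · have h1 : excess f b ≤ f - f ⊓ b := sub_le_sub_left le_sup_left f
    refine h1.trans ?_
    rw [sub_inf, sub_self]
    exact sup_le le_sup_right ((sub_le_sub_right (le_abs_self f) b).trans le_sup_left)
  · rw [excess, neg_sub, sup_sub]
    refine sup_le ((sub_nonpos.2 inf_le_left).trans le_sup_right) (le_trans ?_ le_sup_left)
    rw [sub_eq_add_neg, add_comm, ← sub_eq_add_neg]
    exact sub_le_sub_right (neg_le_abs f) b

variable [Module ℝ F] [IsOrderedModule ℝ F]

/-- If `c • |y| ≤ a` and `c⁻¹ • |x| ≤ b`, then the parts of `x` and `y` outside `[-a, a]` and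
`[-b, b]` are disjoint: they are dominated by multiples of the positive and the negative part of
`|x| - c • |y|`. -/
theorem latDisjoint_excess {x y a b : F} {c : ℝ} (hc : 0 < c) (ha : c • |y| ≤ a)
    (hb : c⁻¹ • |x| ≤ b) : LatDisjoint (excess x a) (excess y b) := by
  set z := |x| - c • |y| with hz
  have hdis : LatDisjoint z⁺ z⁻ := by
    unfold LatDisjoint
    rw [abs_of_nonneg (posPart_nonneg z), abs_of_nonneg (negPart_nonneg z)]
    exact posPart_inf_negPart_eq_zero z
  have h1 : |excess x a| ≤ (1 : ℝ) • |z⁺| := by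
    rw [one_smul, abs_of_nonneg (posPart_nonneg z)]
    exact (abs_excess_le x a).trans (sup_le_sup_right (sub_le_sub_left ha _) 0)
  have h2 : |excess y b| ≤ c⁻¹ • |z⁻| := by
    rw [abs_of_nonneg (negPart_nonneg z)]
    refine (abs_excess_le y b).trans (sup_le ?_ (smul_nonneg (inv_nonneg.2 hc.le)
      (negPart_nonneg z)))
    calc |y| - b ≤ |y| - c⁻¹ • |x| := sub_le_sub_left hb _
      _ = c⁻¹ • (-z) := by rw [hz, neg_sub, smul_sub, inv_smul_smul₀ hc.ne']
      _ ≤ c⁻¹ • z⁻ := smul_le_smul_of_nonneg_left (neg_le_negPart z) (inv_nonneg.2 hc.le)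
  exact ((hdis.of_abs_le_smul h1).symm.of_abs_le_smul h2).symm

end LatticeGroup

variable {F : Type u} [NormedAddCommGroup F] [Lattice F] [IsOrderedAddMonoid F] [HasSolidNorm F]
  [NormedSpace ℝ F] [IsOrderedModule ℝ F] [CompleteSpace F]

/-- Vectors `f k` which are almost disjoint from upper bounds `S k` of their predecessors are
perturbations of disjoint vectors. -/
theorem exists_disjoint_norm_sub_le {f S : ℕ → F} (hf : ∀ k, ‖f k‖ = 1) (hS0 : ∀ k, 0 ≤ S k)
    (hS : ∀ j k, j < k → |f j| ≤ S k)
    (hfS : ∀ k, ‖|f k| ⊓ ((2 : ℝ) ^ (k + 2) • S k)‖ ≤ (1 / 2) ^ (k + 2)) :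
    ∃ d : ℕ → F, Pairwise (fun i j => LatDisjoint (d i) (d j)) ∧
      ∀ k, ‖f k - d k‖ ≤ (1 / 2) ^ (k + 1) := by
  let c : ℕ → ℝ := fun k => (1 / 2) ^ (k + 2)
  have hc : ∀ k, 0 < c k := fun k => by positivity
  have hcinv : ∀ k, (c k)⁻¹ = 2 ^ (k + 2) := fun k => by simp [c]
  have htail : ∀ k, HasSum (fun i => c (k + 1 + i)) (c k) := fun k => by
    have e1 : (fun i => c (k + 1 + i)) = fun i => (1 / 2 : ℝ) ^ (k + 3) * (1 / 2) ^ i :=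
      funext fun i => by
        simp only [c]
        rw [← pow_add]
        congr 1
        omega
    have e2 : c k = (1 / 2) ^ (k + 3) * 2 := by simp only [c, pow_succ]; ring
    rw [e1, e2]
    exact hasSum_geometric_two.mul_left _
  have hnorm : ∀ k i, ‖c (k + 1 + i) • |f (k + 1 + i)|‖ = c (k + 1 + i) := fun k i => by
    rw [norm_smul, norm_abs_eq_norm, hf, mul_one, Real.norm_of_nonneg (hc _).le]
  have hnn : ∀ k i, 0 ≤ c (k + 1 + i) • |f (k + 1 + i)| := fun k i =>
    smul_nonneg (hc _).le (abs_nonneg _)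
  have hsum : ∀ k, Summable fun i => c (k + 1 + i) • |f (k + 1 + i)| := fun k =>
    Summable.of_norm_bounded (htail k).summable fun i => (hnorm k i).le
  -- `b k` dominates large multiples of the earlier vectors and small multiples of the later ones
  let r : ℕ → F := fun k => ∑' i, c (k + 1 + i) • |f (k + 1 + i)|
  let b : ℕ → F := fun k => (2 : ℝ) ^ (k + 2) • S k + r k
  have hr0 : ∀ k, 0 ≤ r k := fun k => tsum_nonneg (hnn k)
  have hs0 : ∀ k, 0 ≤ (2 : ℝ) ^ (k + 2) • S k := fun k => smul_nonneg (by positivity) (hS0 k)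
  have hb0 : ∀ k, 0 ≤ b k := fun k => add_nonneg (hs0 k) (hr0 k)
  have hrn : ∀ k, ‖r k‖ ≤ c k := fun k =>
    tsum_of_norm_bounded (htail k) fun i => (hnorm k i).le
  have hlater : ∀ k m, k < m → c m • |f m| ≤ b k := fun k m hkm => by
    obtain ⟨i, rfl⟩ := Nat.exists_eq_add_of_le (Nat.succ_le_of_lt hkm)
    exact ((hsum k).le_tsum i fun j _ => hnn k j).trans (le_add_of_nonneg_left (hs0 k))
  have hearlier : ∀ k m, k < m → (c m)⁻¹ • |f k| ≤ b m := fun k m hkm => by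
    rw [hcinv]
    exact (smul_le_smul_of_nonneg_left (hS k m hkm) (by positivity)).trans
      (le_add_of_nonneg_right (hr0 m))
  have hlt : ∀ k m, k < m → LatDisjoint (excess (f k) (b k)) (excess (f m) (b m)) :=
    fun k m hkm => latDisjoint_excess (hc m) (hlater k m hkm) (hearlier k m hkm)
  refine ⟨fun k => excess (f k) (b k), fun k m hkm => ?_, fun k => ?_⟩
  · rcases hkm.lt_or_gt with h | h
    · exact hlt k m h
    · exact (hlt m k h).symm
  · have h1 : ‖f k - excess (f k) (b k)‖ ≤ ‖b k ⊓ |f k|‖ := by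
      refine norm_le_norm_of_abs_le_abs ?_
      rw [abs_of_nonneg (le_inf (hb0 k) (abs_nonneg _)), inf_comm]
      exact abs_sub_excess_le _ (hb0 k)
    have h2 : b k ⊓ |f k| ≤ |f k| ⊓ ((2 : ℝ) ^ (k + 2) • S k) + r k := by
      refine (add_inf_le (hs0 k) (hr0 k) (abs_nonneg _)).trans ?_
      rw [inf_comm]
      exact add_le_add le_rfl inf_le_left
    have h3 := norm_le_norm_of_nonneg_of_le (le_inf (hb0 k) (abs_nonneg _)) h2
    have h4 : c k + c k = (1 / 2) ^ (k + 1) := by simp only [c, pow_succ]; ring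
    calc _ ≤ _ := h1.trans (h3.trans (norm_add_le _ _))
      _ ≤ c k + c k := add_le_add (hfS k) (hrn k)
      _ = _ := h4

variable {H : Type v} [NormedAddCommGroup H] [NormedSpace ℝ H]

/-- The Kadec-Pelczynski dichotomy for an operator: if `T` is arbitrarily small on unit vectors which
are arbitrarily close to being disjoint from a given vector, then there is a disjoint sequence of
unit vectors along which `T` is summable. -/
theorem exists_disjoint_summable (T : F →L[ℝ] H)
    (hex : ∀ h : F, 0 ≤ h → ∀ ε > 0, ∃ f : F, ‖f‖ = 1 ∧ ‖|f| ⊓ h‖ < ε ∧ ‖T f‖ < ε) :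
    ∃ d : ℕ → F, Pairwise (fun i j => LatDisjoint (d i) (d j)) ∧ (∀ k, ‖d k‖ = 1) ∧
      Summable fun k => ‖T (d k)‖ := by
  have hex' : ∀ (k : ℕ) (S : {S : F // 0 ≤ S}), ∃ f : F, ‖f‖ = 1 ∧
      ‖|f| ⊓ ((2 : ℝ) ^ (k + 2) • (S : F))‖ < (1 / 2) ^ (k + 2) ∧ ‖T f‖ < (1 / 2) ^ (k + 2) :=
    fun k S => hex _ (smul_nonneg (by positivity) S.2) _ (by positivity)
  choose f hf1 hfS hfT using hex'
  -- `S k` is the sum of the moduli of the vectors chosen before step `k`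
  let S : ℕ → {S : F // 0 ≤ S} := fun n => Nat.rec ⟨0, le_rfl⟩
    (fun k S => ⟨S + |f k S|, add_nonneg S.2 (abs_nonneg _)⟩) n
  have hSsucc : ∀ k, (S (k + 1)).1 = (S k).1 + |f k (S k)| := fun _ => rfl
  have hSmono : Monotone fun k => (S k).1 := monotone_nat_of_le_succ fun k => by
    rw [hSsucc]
    exact le_add_of_nonneg_right (abs_nonneg _)
  obtain ⟨g, hgd, hg⟩ := exists_disjoint_norm_sub_le (f := fun k => f k (S k))
    (S := fun k => (S k).1) (fun k => hf1 _ _) (fun k => (S k).2) (fun j k hjk => by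
      refine le_trans ?_ (hSmono (Nat.succ_le_of_lt hjk))
      change _ ≤ (S (j + 1)).1
      rw [hSsucc]
      exact le_add_of_nonneg_left (S j).2) (fun k => (hfS _ _).le)
  have hgnorm : ∀ k, 1 / 2 ≤ ‖g k‖ := fun k => by
    have h1 := norm_sub_norm_le (f k (S k)) (g k)
    have h2 := hg k
    have h3 : ((1 : ℝ) / 2) ^ (k + 1) ≤ 1 / 2 := by
      rw [pow_succ]
      exact mul_le_of_le_one_left (by norm_num) (pow_le_one₀ (by norm_num) (by norm_num))
    rw [hf1] at h1
    linarith
  have hgpos : ∀ k, 0 < ‖g k‖ := fun k => lt_of_lt_of_le (by norm_num) (hgnorm k)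
  have hgT : ∀ k, ‖T (g k)‖ ≤ (1 / 2) ^ k * (1 + ‖T‖) := fun k => by
    have h1 : T (g k) = T (f k (S k)) - T (f k (S k) - g k) := by rw [← map_sub, sub_sub_cancel]
    have h2 := (T.le_opNorm (f k (S k) - g k)).trans
      (mul_le_mul_of_nonneg_left (hg k) (norm_nonneg T))
    have h3 : ((1 : ℝ) / 2) ^ (k + 2) ≤ (1 / 2) ^ k :=
      pow_le_pow_of_le_one (by norm_num) (by norm_num) (by omega)
    have h4 : ‖T‖ * ((1 : ℝ) / 2) ^ (k + 1) ≤ ‖T‖ * (1 / 2) ^ k :=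
      mul_le_mul_of_nonneg_left (pow_le_pow_of_le_one (by norm_num) (by norm_num) (by omega))
        (norm_nonneg T)
    rw [h1]
    linarith [norm_sub_le (T (f k (S k))) (T (f k (S k) - g k)), hfT k (S k)]
  refine ⟨fun k => ‖g k‖⁻¹ • g k, fun i j hij => ((hgd hij).smul _).symm.smul _ |>.symm,
    fun k => ?_, ?_⟩
  · rw [norm_smul, norm_inv, norm_norm, inv_mul_cancel₀ (hgpos k).ne']
  · refine Summable.of_nonneg_of_le (fun k => norm_nonneg _) (fun k => ?_)
      ((summable_geometric_two.mul_right (1 + ‖T‖)).mul_left 2)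
    rw [map_smul, norm_smul, norm_inv, norm_norm]
    refine mul_le_mul ?_ (hgT k) (norm_nonneg _) (by norm_num)
    rw [inv_le_comm₀ (hgpos k) (by norm_num)]
    linarith [hgnorm k]

end KadecPelczynski

/-! ### Strict singularity on spans of disjoint sequences -/

theorem Submodule.exists_mem_ne_zero_map_eq_zero {K E E' : Type*} [DivisionRing K] [AddCommGroup E]
    [Module K E] [AddCommGroup E'] [Module K E'] [FiniteDimensional K E'] {V : Submodule K E}
    (hV : ¬ FiniteDimensional K V) (φ : E →ₗ[K] E') : ∃ a ∈ V, a ≠ 0 ∧ φ a = 0 := by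
  have hker : LinearMap.ker (φ.domRestrict V) ≠ ⊥ := fun h =>
    hV (FiniteDimensional.of_injective (φ.domRestrict V) (LinearMap.ker_eq_bot.1 h))
  obtain ⟨a, ha, ha0⟩ := (Submodule.ne_bot_iff _).1 hker
  exact ⟨a, a.2, fun h => ha0 (Subtype.ext h), ha⟩

theorem exists_ne_zero_forall_lt_eq_zero {V : Submodule ℝ (ℕ →₀ ℝ)} (hV : ¬ FiniteDimensional ℝ V)
    (n : ℕ) : ∃ a ∈ V, a ≠ 0 ∧ ∀ k < n, a k = 0 := by
  obtain ⟨a, ha, ha0, h⟩ := Submodule.exists_mem_ne_zero_map_eq_zero hV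
    (LinearMap.pi fun i : Fin n => Finsupp.lapply (i : ℕ))
  exact ⟨a, ha, ha0, fun k hk => congrFun h ⟨k, hk⟩⟩

section DisjointSpan

variable {F : Type u} [NormedAddCommGroup F] [Lattice F] [IsOrderedAddMonoid F] [HasSolidNorm F]
  [NormedSpace ℝ F] [IsOrderedModule ℝ F]

/-- The terms of a linear combination of disjoint vectors are bounded by the combination. -/
theorem norm_smul_le_norm_linearCombination {f : ℕ → F}
    (hd : Pairwise fun i j => LatDisjoint (f i) (f j)) (a : ℕ →₀ ℝ) (k : ℕ) :
    ‖a k • f k‖ ≤ ‖Finsupp.linearCombination ℝ f a‖ := by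
  classical
  by_cases hk : k ∈ a.support
  · rw [Finsupp.linearCombination_apply, Finsupp.sum, ← Finset.add_sum_erase _ _ hk]
    refine norm_le_norm_of_abs_le_abs (LatDisjoint.abs_le_abs_add ?_)
    refine (LatDisjoint.sum fun j hj => ?_).symm
    exact (((hd (Finset.ne_of_mem_erase hj)).smul _).symm.smul _).symm
  · rw [Finsupp.notMem_support_iff.1 hk, zero_smul, norm_zero]
    exact norm_nonneg _

theorem linearIndependent_of_disjoint {f : ℕ → F} (hne : ∀ k, f k ≠ 0)
    (hd : Pairwise fun i j => LatDisjoint (f i) (f j)) : LinearIndependent ℝ f := by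
  refine linearIndependent_iff.2 fun a ha => Finsupp.ext fun k => ?_
  have h1 := norm_smul_le_norm_linearCombination hd a k
  rw [ha, norm_zero, norm_le_zero_iff, smul_eq_zero] at h1
  exact h1.resolve_right (hne k)

variable {H : Type v} [NormedAddCommGroup H] [NormedSpace ℝ H]

/-- An operator which is summable along a disjoint sequence of unit vectors is strictly singular on
its span. An infinite dimensional subspace contains nonzero combinations of the vectors
from any index on, and the coefficients of a combination are bounded by its norm. -/
theorem isStrictlySingular_of_summable {d : ℕ → F}
    (hd : Pairwise fun i j => LatDisjoint (d i) (d j)) (hd1 : ∀ k, ‖d k‖ = 1) {T : F →L[ℝ] H}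
    (hT : Summable fun k => ‖T (d k)‖) :
    IsStrictlySingular (T.comp (Submodule.span ℝ (Set.range d)).subtypeL) := by
  rintro G hG ⟨c, hc, hbound⟩
  obtain ⟨n, hn⟩ := ((tendsto_sum_nat_add fun k => ‖T (d k)‖).eventually_lt_const hc).exists
  let p := Finsupp.linearCombination ℝ d
  let G₀ : Submodule ℝ F := G.map (Submodule.span ℝ (Set.range d)).subtype
  have hinf : ¬ FiniteDimensional ℝ (G₀.comap p) := fun hfin => hG (by
    have hmap : (G₀.comap p).map p = G₀ := Submodule.map_comap_eq_self (by
      rw [Finsupp.range_linearCombination]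
      exact Submodule.map_subtype_le _ _)
    have : FiniteDimensional ℝ G₀ := by
      rw [← hmap]
      infer_instance
    exact (Submodule.equivMapOfInjective _ (Submodule.injective_subtype _) G).symm.finiteDimensional)
  obtain ⟨a, ha, ha0, han⟩ := exists_ne_zero_forall_lt_eq_zero hinf n
  have hcoef : ∀ k, |a k| ≤ ‖p a‖ := fun k => by
    have := norm_smul_le_norm_linearCombination hd a k
    rwa [norm_smul, hd1, mul_one, Real.norm_eq_abs] at this
  have hpos : 0 < ‖p a‖ := by
    obtain ⟨k, hk⟩ := Finsupp.ne_iff.1 ha0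
    exact (abs_pos.2 hk).trans_le (hcoef k)
  obtain ⟨y, hy, hyp⟩ := ha
  have hlow : c * ‖p a‖ ≤ ‖T (p a)‖ := by
    have := hbound y hy
    rw [← hyp]
    exact this
  have hsum : Summable fun k => ‖T (d (k + n))‖ := (summable_nat_add_iff n).2 hT
  have hup : ‖T (p a)‖ ≤ ‖p a‖ * ∑' k, ‖T (d (k + n))‖ := by
    have hsupp : ∀ k ∈ a.support, n ≤ k := fun k hk => by
      by_contra! h
      exact Finsupp.mem_support_iff.1 hk (han k h)
    calc ‖T (p a)‖ = ‖∑ k ∈ a.support, a k • T (d k)‖ := by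
          simp only [p, Finsupp.linearCombination_apply, Finsupp.sum, map_sum, map_smul]
      _ ≤ ∑ k ∈ a.support, ‖p a‖ * ‖T (d k)‖ := by
          refine norm_sum_le_of_le _ fun k _ => ?_
          rw [norm_smul, Real.norm_eq_abs]
          exact mul_le_mul_of_nonneg_right (hcoef k) (norm_nonneg _)
      _ = ‖p a‖ * ∑ k ∈ a.support, ‖T (d k)‖ := (Finset.mul_sum _ _ _).symm
      _ = ‖p a‖ * ∑ k ∈ a.support.image (· - n), ‖T (d (k + n))‖ := by
          rw [Finset.sum_image fun x hx y hy h => by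
            have := hsupp x hx
            have := hsupp y hy
            have h : x - n = y - n := h
            omega]
          congr 1
          exact Finset.sum_congr rfl fun k hk => by rw [Nat.sub_add_cancel (hsupp k hk)]
      _ ≤ _ := mul_le_mul_of_nonneg_left
          (hsum.sum_le_tsum _ fun k _ => norm_nonneg _) (norm_nonneg _)
  have : ‖p a‖ * ∑' k, ‖T (d (k + n))‖ < ‖p a‖ * c := mul_lt_mul_of_pos_left hn hpos
  linarith

/-- If `T` is strictly singular on the span of a disjoint sequence, then beyond every index there is
a unit block of the sequence on which `T` is small. -/
theorem IsStrictlySingular.exists_block {f : ℕ → F} (hne : ∀ k, f k ≠ 0)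
    (hd : Pairwise fun i j => LatDisjoint (f i) (f j)) {T : F →L[ℝ] H}
    (hT : IsStrictlySingular (T.comp (Submodule.span ℝ (Set.range f)).subtypeL)) {r : ℝ}
    (hr : 0 < r) (N : ℕ) : ∃ M ≥ N, ∃ x ∈ Submodule.span ℝ (f '' Set.Ico N M),
      ‖x‖ = 1 ∧ ‖T x‖ ≤ r := by
  let E := Submodule.span ℝ (Set.range f)
  let G : Submodule ℝ E := (Submodule.span ℝ (f '' Set.Ici N)).comap E.subtype
  have hG : ¬ FiniteDimensional ℝ G := fun hfin => by
    let w : ℕ → G := fun n => ⟨⟨f (N + n), Submodule.subset_span ⟨_, rfl⟩⟩,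
      Submodule.subset_span ⟨N + n, by simp, rfl⟩⟩
    have hw : LinearIndependent ℝ w := by
      refine LinearIndependent.of_comp (E.subtype.comp G.subtype) ?_
      exact (linearIndependent_of_disjoint hne hd).comp (fun n => N + n) (add_right_injective N)
    have := hw.finite
    exact not_finite ℕ
  have hx := hT G hG
  push Not at hx
  obtain ⟨x, hxG, hxr⟩ := hx r hr
  have hxr : ‖T (x : F)‖ < r * ‖(x : F)‖ := hxr
  have hx0 : 0 < ‖(x : F)‖ := by
    by_contra! h
    have := mul_nonpos_of_nonneg_of_nonpos hr.le h
    linarith [norm_nonneg (T (x : F))]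
  have hxG : (x : F) ∈ Submodule.span ℝ (f '' Set.Ici N) := hxG
  obtain ⟨a, ha, hax⟩ := (Finsupp.mem_span_image_iff_linearCombination ℝ).1 hxG
  refine ⟨max N (a.support.sup id + 1), le_max_left _ _, ‖(x : F)‖⁻¹ • (x : F),
    Submodule.smul_mem _ _ ?_, ?_, ?_⟩
  · refine (Finsupp.mem_span_image_iff_linearCombination ℝ).2 ⟨a, ?_, hax⟩
    refine (Finsupp.mem_supported ℝ a).2 fun k hk => ⟨(Finsupp.mem_supported ℝ a).1 ha hk, ?_⟩
    exact lt_max_of_lt_right (Nat.lt_succ_of_le (Finset.le_sup (f := id) hk))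
  · rw [norm_smul, norm_inv, norm_norm, inv_mul_cancel₀ hx0.ne']
  · rw [map_smul, norm_smul, norm_inv, norm_norm, inv_mul_le_iff₀ hx0]
    linarith

theorem IsInftyDNS.isDNS {T : F →L[ℝ] H} (hT : IsInftyDNS T) : IsDNS T := by
  obtain ⟨r, hr, hno⟩ := hT
  intro f hne hd hss
  choose M hM x hx hx1 hxr using fun N => hss.exists_block hne hd hr N
  let N : ℕ → ℕ := fun k => M^[k] 0
  have hNsucc : ∀ k, N (k + 1) = M (N k) := fun k => Function.iterate_succ_apply' M k 0
  have hN : Monotone N := monotone_nat_of_le_succ fun k => by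
    rw [hNsucc]
    exact hM _
  have hlt : ∀ i j, i < j → LatDisjoint (x (N i)) (x (N j)) := fun i j hij => by
    refine LatDisjoint.span_span ?_ (hx (N i)) (hx (N j))
    rintro _ ⟨k, hk, rfl⟩ _ ⟨m, hm, rfl⟩
    refine hd (ne_of_lt ?_)
    have h1 : N (i + 1) ≤ N j := hN hij
    rw [hNsucc] at h1
    exact hk.2.trans_le (h1.trans hm.1)
  refine hno ⟨fun k => x (N k), fun i j hij => ?_, fun k => ⟨hx1 _, hxr _⟩⟩
  rcases hij.lt_or_gt with h | h
  · exact hlt i j h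
  · exact (hlt j i h).symm

theorem IsDNS.complements [CompleteSpace F] {T : F →L[ℝ] H} (hT : IsDNS T) :
    Complements T (unTopology F) := by
  rintro ⟨P, _, _, _, f, hf1, hf, hfT⟩
  obtain ⟨d, hd, hd1, hsum⟩ := exists_disjoint_summable T fun h hh ε hε => by
    have hfh := tendsto_nhds_unTopology.1 hf h hh
    simp only [sub_zero] at hfh
    obtain ⟨p, h1, h2⟩ := ((hfh.eventually_lt_const hε).and (hfT.eventually_lt_const hε)).exists
    exact ⟨f p, hf1 p, h1, h2⟩
  exact hT d (fun k h => by simpa [h] using hd1 k) hd (isStrictlySingular_of_summable hd hd1 hsum)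

end DisjointSpan

/-! ### The cycle of implications -/

section Implications

variable {F : Type u} [NormedAddCommGroup F] [NormedSpace ℝ F]
  {H : Type v} [NormedAddCommGroup H] [NormedSpace ℝ H] {T : F →L[ℝ] H}

theorem Complements.seqComplements {t : TopologicalSpace F} (hT : Complements T t) :
    SeqComplements T t := by
  rintro ⟨f, hf1, hf, hfT⟩
  have hdown : Tendsto (ULift.down : ULift.{u} ℕ → ℕ) atTop atTop :=
    tendsto_atTop.2 fun n => eventually_ge_atTop (ULift.up.{u} n)
  have : IsDirectedOrder (ULift.{u} ℕ) :=
    ⟨fun a b => ⟨⟨max a.down b.down⟩, le_max_left a.down b.down, le_max_right a.down b.down⟩⟩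
  exact hT ⟨ULift.{u} ℕ, inferInstance, this, inferInstance, fun n => f n.down,
    fun n => hf1 _, hf.comp hdown, hfT.comp hdown⟩

theorem IsNDNS.isInftyDNS [Lattice F] {n : ℕ} (hT : IsNDNS n T) : IsInftyDNS T := by
  obtain ⟨r, hr, hno⟩ := hT
  exact ⟨r, hr, fun ⟨f, hd, hf⟩ => hno ⟨fun k => f k,
    fun i j hij => hd (fun h => hij (Fin.ext h)), fun k => hf k⟩⟩

end Implications

theorem mainTheorem1
    {F : Type u} [NormedAddCommGroup F] [Lattice F] [IsOrderedAddMonoid F] [HasSolidNorm F]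
    [NormedSpace ℝ F] [IsOrderedModule ℝ F] [CompleteSpace F]
    {H : Type v} [NormedAddCommGroup H] [NormedSpace ℝ H] [CompleteSpace H]
    (hF : HasOrderContinuousNorm F) (T : F →L[ℝ] H) :
    ∃ τ : TopologicalSpace F,
      IsMinimalHausdorffOrderContinuous τ ∧ τ = unTopology F ∧ τ = uawTopology F ∧
      List.TFAE [
        IsDNS T,
        IsInftyDNS T,
        ∃ n : ℕ, 2 ≤ n ∧ IsNDNS n T,
        Complements T τ,
        SeqComplements T τ] := by
  refine ⟨unTopology F, isMinimalHausdorffOrderContinuous_unTopology hF, rfl,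
    unTopology_eq_uawTopology hF, ?_⟩
  tfae_have 1 → 4 := IsDNS.complements
  tfae_have 4 → 5 := Complements.seqComplements
  tfae_have 5 → 3 := SeqComplements.exists_isNDNS hF
  tfae_have 3 → 2 := fun ⟨_, _, h⟩ => h.isInftyDNS
  tfae_have 2 → 1 := IsInftyDNS.isDNS
  tfae_finish
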